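/- Let $X$ be a smooth complex variety, that is, either a smooth separated scheme of finite type over $\mathbb{C}$ with its Zariski topology and structure sheaf $\mathcal{O}_X$, or a complex manifold of dimension $n$ with its sheaf $\mathcal{O}_X$ of holomorphic functions. Put $\mathbb{C}^\hbar=\mathbb{C}[[\hbar]]$ and $\mathbb{C}^{\hbar,loc}=\mathbb{C}((\hbar))$. A star product on $\mathcal{O}_X[[\hbar]]$ is an associative $\mathbb{C}^\hbar$-bilinear multiplication $\star$ with $f\star g=\sum_{i\ge 0}P_i(f,g)\hbar^i$ for $f,g\in\mathcal{O}_X$, where the $P_i$ are bidifferential operators, $P_0(f,g)=fg$, and $P_i(f,1)=P_i(1,f)=0$ for $i>0$. A DQ-algebroid on $X$ is a $\mathbb{C}^\hbar$-linear stack $\mathcal{A}_X$ on $X$ which is locally non-empty, in which any two objects over an open set are locally isomorphic, and such that for every open $U\subset X$ and every $\sigma\in\mathcal{A}_X(U)$ the sheaf of $\mathbb{C}^\hbar$-algebras $\mathcal{E}nd(\sigma)$ on $U$ is locally isomorphic to an algebra $(\mathcal{O}_X[[\hbar]],\star)$ for some star product $\star$. Let $\mathcal{A}_X$ be a DQ-algebroid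 on $X$. Let $\mathrm{Mod}(\mathcal{A}_X)$ be the abelian category of $\mathbb{C}^\hbar$-linear functors of stacks from $\mathcal{A}_X$ to the stack $U\mapsto\mathrm{Mod}(\mathbb{C}^\hbar_U)$ of sheaves of $\mathbb{C}^\hbar$-modules, let $\mathsf{D}(\mathcal{A}_X)$ be its derived category, and let $\mathsf{D}^{-}(\mathcal{A}_X)\subset\mathsf{D}(\mathcal{A}_X)$ be the full subcategory of the objects whose cohomology vanishes in all sufficiently large degrees. Put $\mathcal{A}_X^{loc}=\mathbb{C}^{\hbar,loc}\otimes_{\mathbb{C}^\hbar}\mathcal{A}_X$, an $\mathcal{A}_X$-bimodule, and let $\mathrm{R}\mathcal{H}om_{\mathcal{A}_X}(\mathcal{A}_X^{loc},\cdot)$ be the right derived functor of $\mathcal{H}om_{\mathcal{A}_X}(\mathcal{A}_X^{loc},\cdot)\colon\mathrm{Mod}(\mathcal{A}_X)\to\mathrm{Mod}(\mathcal{A}_X)$, computed on $\mathsf{D}(\mathcal{A}_X)$ by K-injective resolutions. Then $$\mathrm{R}\mathcal{H}om_{\mathcal{A}_X}\bigl(\mathcal{A}_X^{loc},\mathsf{D}^{-}(\mathcal{A}_X)\bigr)\subset\mathsf{D}^{-}(\mathcal{A}_X).$$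 -/

import Mathlib

open CategoryTheory Opposite TopologicalSpace Limits AlgebraicGeometry
open scoped ZeroObject Manifold ContDiff PowerSeries LaurentSeries Bicategory DirectSum

universe w

noncomputable section

namespace DQ

/-- A topological space with a sheaf of commutative `ℂ`-algebras (the algebra structure is given by
the constant global sections). -/
structure CAlgSpace where
  space : TopCat.{0}
  sheaf : TopCat.Sheaf CommRingCat.{0} space
  const : ℂ →+* sheaf.presheaf.obj (op ⊤)

/-- A smooth complex variety: either a smooth, separated, quasi-compact scheme over `ℂ`
(with its Zariski topology), or a complex manifold of dimension `n`. -/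
inductive SmoothComplexVariety : Type 1
  | algebraic (S : Scheme.{0}) (f : S ⟶ Spec (CommRingCat.of ℂ))
      (smooth : Smooth f) (separated : IsSeparated f) (quasiCompact : QuasiCompact f)
  | analytic (n : ℕ) (M : Type) [TopologicalSpace M] [T2Space M]
      [ChartedSpace (EuclideanSpace ℂ (Fin n)) M]
      [IsManifold 𝓘(ℂ, EuclideanSpace ℂ (Fin n)) ∞ M]

/-- The underlying space with its structure sheaf `𝒪_X`: the structure sheaf of the scheme, or the
sheaf of holomorphic functions. -/
def SmoothComplexVariety.toCAlgSpace : SmoothComplexVariety → CAlgSpace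
  | algebraic S f _ _ _ =>
    { space := S.toTopCat
      sheaf := S.sheaf
      const := ((Scheme.ΓSpecIso (CommRingCat.of ℂ)).inv ≫ f.appTop).hom }
  | @analytic n M _ _ _ _ =>
    { space := TopCat.of M
      sheaf := smoothSheafCommRing 𝓘(ℂ, EuclideanSpace ℂ (Fin n)) 𝓘(ℂ) M ℂ
      const := algebraMap ℂ C^∞⟮𝓘(ℂ, EuclideanSpace ℂ (Fin n)), (⊤ : Opens M); 𝓘(ℂ), ℂ⟯ }

namespace CAlgSpace

variable (X : CAlgSpace)

/-- The sections of the structure sheaf over `U`. -/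
def Sec (U : Opens X.space) : Type := X.sheaf.presheaf.obj (op U)

instance (U : Opens X.space) : CommRing (X.Sec U) :=
  inferInstanceAs (CommRing (X.sheaf.presheaf.obj (op U)))

/-- Restriction of sections. -/
def res {U V : Opens X.space} (h : V ≤ U) : X.Sec U →+* X.Sec V :=
  (X.sheaf.presheaf.map (homOfLE h).op).hom

instance (U : Opens X.space) : Algebra ℂ (X.Sec U) :=
  ((X.res (le_top : U ≤ ⊤)).comp X.const).toAlgebra

end CAlgSpace

/-- `D` is a differential operator of order at most `k` (in the sense of Grothendieck). -/
def IsDiffOp {A : Type} [CommRing A] [Algebra ℂ A] : ℕ → (A →ₗ[ℂ] A) → Prop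
  | 0, D => ∀ a b : A, D (a * b) = a * D b
  | k + 1, D => ∀ a : A, IsDiffOp k (D ∘ₗ LinearMap.mulLeft ℂ a - LinearMap.mulLeft ℂ a ∘ₗ D)

/-- A sequence `P 0, P 1, …` of bidifferential operators on the structure sheaf over `V`:
`ℂ`-bilinear, compatible with restrictions, and locally of finite order in each argument. -/
structure BidiffSeq (X : CAlgSpace) (V : Opens X.space) where
  P : ℕ → ∀ W : Opens X.space, W ≤ V → (X.Sec W →ₗ[ℂ] X.Sec W →ₗ[ℂ] X.Sec W)
  res_P : ∀ (n : ℕ) (W W' : Opens X.space) (hW : W ≤ V) (h : W' ≤ W) (f g : X.Sec W),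
    X.res h (P n W hW f g) = P n W' (h.trans hW) (X.res h f) (X.res h g)
  locally_finite_order : ∀ (n : ℕ) (x : X.space), x ∈ V →
    ∃ (V' : Opens X.space) (hV' : V' ≤ V), x ∈ V' ∧ ∃ k : ℕ,
      ∀ (W : Opens X.space) (hW : W ≤ V') (f : X.Sec W),
        IsDiffOp k (P n W (hW.trans hV') f) ∧ IsDiffOp k ((P n W (hW.trans hV')).flip f)

/-- The `ℂ⟦ħ⟧`-bilinear product on `𝒪⟦ħ⟧` with `f ⋆ g = ∑ᵢ Pᵢ(f, g) ħⁱ` for `f, g ∈ 𝒪`. -/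
def BidiffSeq.mul {X : CAlgSpace} {V : Opens X.space} (B : BidiffSeq X V)
    {W : Opens X.space} (hW : W ≤ V) (f g : (X.Sec W)⟦X⟧) : (X.Sec W)⟦X⟧ :=
  PowerSeries.mk fun n => ∑ p ∈ Finset.HasAntidiagonal.antidiagonal n,
    ∑ q ∈ Finset.HasAntidiagonal.antidiagonal p.2,
      B.P p.1 W hW (PowerSeries.coeff q.1 f) (PowerSeries.coeff q.2 g)

/-- A star product on `𝒪⟦ħ⟧` over `V`. -/
structure StarProduct (X : CAlgSpace) (V : Opens X.space) extends BidiffSeq X V where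
  P_zero : ∀ (W : Opens X.space) (hW : W ≤ V) (f g : X.Sec W), P 0 W hW f g = f * g
  P_one : ∀ (n : ℕ) (W : Opens X.space) (hW : W ≤ V) (f : X.Sec W), 0 < n →
    P n W hW f 1 = 0 ∧ P n W hW 1 f = 0
  mul_assoc : ∀ (W : Opens X.space) (hW : W ≤ V) (f g h : (X.Sec W)⟦X⟧),
    toBidiffSeq.mul hW (toBidiffSeq.mul hW f g) h = toBidiffSeq.mul hW f (toBidiffSeq.mul hW g h)

/-- An `R`-algebroid stack on `X`: an `R`-linear stack which is locally non-empty and in which any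
two objects are locally isomorphic. -/
structure Algebroid (R : Type) [CommRing R] (X : TopCat.{0}) where
  F : LocallyDiscrete (Opens X)ᵒᵖ ⥤ᵖ Cat.{0, 0}
  isStack : F.IsStack (Opens.grothendieckTopology X)
  preadditive : ∀ U, Preadditive (F.obj U)
  linear : ∀ U, Linear R (F.obj U)
  map_additive : ∀ {U V} (f : U ⟶ V), (F.map f).toFunctor.Additive
  map_linear : ∀ {U V} (f : U ⟶ V), (F.map f).toFunctor.Linear R
  locally_nonempty : ∀ x : X, ∃ U : Opens X, x ∈ U ∧ Nonempty (F.obj (.mk (op U)))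
  locally_iso : ∀ (U : Opens X) (σ τ : F.obj (.mk (op U))) (x : X), x ∈ U →
    ∃ (V : Opens X) (i : V ⟶ U), x ∈ V ∧
      Nonempty ((F.map i.op.toLoc).toFunctor.obj σ ≅ (F.map i.op.toLoc).toFunctor.obj τ)

namespace Algebroid
attribute [instance] preadditive linear map_additive map_linear

variable {R : Type} [CommRing R] {X : TopCat.{0}} (A : Algebroid R X)

/-- The total category of the stack: objects are pairs `(U, σ)` with `σ ∈ 𝒜(U)`, and a morphism
`(U, σ) ⟶ (V, τ)` is an inclusion `V ⊆ U` together with a morphism `σ|_V ⟶ τ` in `𝒜(V)`. -/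
abbrev Total : Type := A.F.Grothendieck

/-- The opposite of the total category, on which modules over `𝒜` are contravariant. -/
abbrev Site : Type := A.Totalᵒᵖ

/-- The morphism `(U, σ) ⟶ (V, τ)` given by `i : V ⊆ U` and `a : σ|_V ⟶ τ`. -/
def homMk {c d : A.Total} (i : c.base ⟶ d.base)
    (a : (A.F.map i.toLoc).toFunctor.obj c.fiber ⟶ d.fiber) : c ⟶ d := ⟨i, a⟩

/-- The restriction `(V, σ|_V)` of `(U, σ)`. -/
def restrict (c : A.Total) {V : Opens X} (i : V ⟶ c.base.unop) : A.Total :=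
  ⟨op V, (A.F.map i.op.toLoc).toFunctor.obj c.fiber⟩

/-- The canonical morphism `(U, σ) ⟶ (V, σ|_V)`. -/
def toRestrict (c : A.Total) {V : Opens X} (i : V ⟶ c.base.unop) : c ⟶ A.restrict c i :=
  A.homMk (d := A.restrict c i) i.op (𝟙 _)

lemma exists_linear_fac {c e : A.Total} {V : Opens X} (i : V ⟶ c.base.unop)
    (j : e.base.unop ⟶ V) (b : c.base ⟶ e.base) :
    ∃ K : ((A.F.map b.toLoc).toFunctor.obj c.fiber ⟶ e.fiber) →ₗ[R]
        ((A.F.map j.op.toLoc).toFunctor.obj (A.restrict c i).fiber ⟶ e.fiber),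
      ∀ f, A.toRestrict c i ≫ A.homMk (c := A.restrict c i) j.op (K f) = A.homMk b f := by
  obtain rfl : b = i.op ≫ j.op := Subsingleton.elim _ _
  refine ⟨Linear.leftComp R _
    ((A.F.mapComp i.op.toLoc j.op.toLoc).inv.toNatTrans.app c.fiber), fun f => ?_⟩
  refine Pseudofunctor.Grothendieck.Hom.ext _ _ rfl ?_
  have h : (A.F.mapComp i.op.toLoc j.op.toLoc).hom.toNatTrans.app c.fiber ≫
      (A.F.mapComp i.op.toLoc j.op.toLoc).inv.toNatTrans.app c.fiber = 𝟙 _ := by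
    rw [← Cat.Hom₂.comp_app, Iso.hom_inv_id]; rfl
  change 𝟙 _ ≫ (A.F.mapComp i.op.toLoc j.op.toLoc).hom.toNatTrans.app c.fiber ≫
    (A.F.map j.op.toLoc).toFunctor.map (𝟙 ((A.F.map i.op.toLoc).toFunctor.obj c.fiber)) ≫
    (A.F.mapComp i.op.toLoc j.op.toLoc).inv.toNatTrans.app c.fiber ≫ f = f
  erw [CategoryTheory.Functor.map_id, Category.id_comp, Category.id_comp]
  exact (Category.assoc _ _ _).symm.trans ((congrArg (· ≫ f) h).trans (Category.id_comp f))

lemma exists_fac {c e : A.Total} {V : Opens X} (i : V ⟶ c.base.unop) (j : e.base.unop ⟶ V)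
    (g : c ⟶ e) : ∃ k : A.restrict c i ⟶ e, A.toRestrict c i ≫ k = g := by
  obtain ⟨K, hK⟩ := A.exists_linear_fac i j g.base
  exact ⟨_, hK g.fiber⟩

lemma exists_linear_comp {c d e : A.Total} (i : c.base ⟶ d.base) (g : d ⟶ e) :
    ∃ K : ((A.F.map i.toLoc).toFunctor.obj c.fiber ⟶ d.fiber) →ₗ[R]
        ((A.F.map (i ≫ g.base).toLoc).toFunctor.obj c.fiber ⟶ e.fiber),
      ∀ a, A.homMk i a ≫ g = A.homMk (i ≫ g.base) (K a) :=
  ⟨Linear.leftComp R _ ((A.F.mapComp i.toLoc g.base.toLoc).hom.toNatTrans.app c.fiber) ∘ₗ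
    Linear.rightComp R _ g.fiber ∘ₗ (A.F.map g.base.toLoc).toFunctor.mapLinearMap R,
    fun _ => rfl⟩

/-- A sieve on `(U, σ)` is covering if the open sets `V ⊆ U` whose restriction morphism
`(U, σ) ⟶ (V, σ|_V)` it contains cover `U`. -/
def topology : GrothendieckTopology A.Site where
  sieves c := {S | ∀ x ∈ c.unop.base.unop, ∃ (V : Opens X) (i : V ⟶ c.unop.base.unop),
    x ∈ V ∧ S.arrows (A.toRestrict c.unop i).op}
  top_mem' c x hx := ⟨_, 𝟙 _, hx, trivial⟩
  pullback_stable' c d S f hS x hx := by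
    obtain ⟨V, i, hxV, hV⟩ := hS x (leOfHom f.unop.base.unop hx)
    refine ⟨V ⊓ d.unop.base.unop, homOfLE inf_le_right, ⟨hxV, hx⟩, ?_⟩
    obtain ⟨k, hk⟩ := A.exists_fac i (homOfLE inf_le_left)
      (f.unop ≫ A.toRestrict d.unop (homOfLE (inf_le_right : V ⊓ d.unop.base.unop ≤ _)))
    have := S.downward_closed hV k.op
    rw [← op_comp, hk] at this
    exact this
  transitive' c S hS T hT x hx := by
    obtain ⟨V, i, hxV, hV⟩ := hS x hx
    obtain ⟨W, j, hxW, hW⟩ := hT hV x hxV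
    refine ⟨W, j ≫ i, hxW, ?_⟩
    obtain ⟨k, hk⟩ := A.exists_fac i j (A.toRestrict c.unop (j ≫ i))
    obtain ⟨l, hl⟩ := A.exists_fac j (𝟙 W) k
    have := T.downward_closed hW l.op
    have e : l.op ≫ (A.toRestrict (A.restrict c.unop i) j).op ≫ (A.toRestrict c.unop i).op
        = (A.toRestrict c.unop (j ≫ i)).op := by
      rw [← op_comp, ← op_comp, Category.assoc, hl, hk]
    rwa [← e]

/-- `N` is `R`-linear on the morphisms lying over a fixed inclusion of open sets. -/
structure IsLinear (N : A.Siteᵒᵖ ⥤ ModuleCat.{0} R) : Prop where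
  map_add {c d : A.Total} (i : c.base ⟶ d.base)
    (a b : (A.F.map i.toLoc).toFunctor.obj c.fiber ⟶ d.fiber) :
    N.map (A.homMk i (a + b)).op.op = N.map (A.homMk i a).op.op + N.map (A.homMk i b).op.op
  map_smul {c d : A.Total} (i : c.base ⟶ d.base) (r : R)
    (a : (A.F.map i.toLoc).toFunctor.obj c.fiber ⟶ d.fiber) :
    N.map (A.homMk i (r • a)).op.op = r • N.map (A.homMk i a).op.op

/-- The linear sheaves of `R`-modules on the total category. -/
def isModule : ObjectProperty (Sheaf A.topology (ModuleCat.{0} R)) := fun N => A.IsLinear N.obj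

variable {A} in
lemma IsLinear.of_injective {M N : A.Siteᵒᵖ ⥤ ModuleCat.{0} R} (f : M ⟶ N)
    (hf : ∀ c, Mono (f.app c)) (hN : A.IsLinear N) : A.IsLinear M where
  map_add i a b := by
    rw [← cancel_mono (f.app _)]
    simp only [Preadditive.add_comp, NatTrans.naturality, hN.map_add, Preadditive.comp_add]
  map_smul i r a := by
    rw [← cancel_mono (f.app _)]
    simp only [Linear.smul_comp, NatTrans.naturality, hN.map_smul, Linear.comp_smul]

instance : A.isModule.IsClosedUnderSubobjects where
  prop_of_mono {M N} f _ hN := by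
    have : Mono f.hom := inferInstanceAs (Mono ((sheafToPresheaf _ _).map f))
    exact IsLinear.of_injective f.hom (fun c => inferInstance) hN

lemma eq_of_locally_eq (N : Sheaf A.topology (ModuleCat.{0} R)) {d : A.Total}
    (y z : N.obj.obj (op (op d)))
    (h : ∀ x ∈ d.base.unop, ∃ (W : Opens X) (j : W ⟶ d.base.unop), x ∈ W ∧
      N.obj.map (A.toRestrict d j).op.op y = N.obj.map (A.toRestrict d j).op.op z) : y = z := by
  have hN : Presieve.IsSheaf A.topology (N.obj ⋙ forget _) :=
    (isSheaf_iff_isSheaf_of_type _ _).1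
      ((Presheaf.isSheaf_iff_isSheaf_forget A.topology N.obj (forget _)).1 N.property)
  refine (hN.isSeparated (Presheaf.equalizerSieve (F := N.obj) y z) h).ext fun e f hf => hf

instance : A.isModule.IsClosedUnderQuotients where
  prop_of_epi {M N} f _ hM := by
    have hs := (Sheaf.isLocallySurjective_iff_epi' (J := A.topology) (A := ModuleCat.{0} R) f).2
      inferInstance
    have key {c d : A.Total} (i : c.base ⟶ d.base) (q : N.obj.obj (op (op c))) (x : X)
        (hx : x ∈ d.base.unop) : ∃ (W : Opens X) (j : W ⟶ d.base.unop) (e : A.Total)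
          (b : e.base ⟶ (A.restrict d j).base)
          (K : ((A.F.map i.toLoc).toFunctor.obj c.fiber ⟶ d.fiber) →ₗ[R]
            ((A.F.map b.toLoc).toFunctor.obj e.fiber ⟶ (A.restrict d j).fiber))
          (m : M.obj.obj (op (op e))), x ∈ W ∧
          ∀ a, N.obj.map (A.toRestrict d j).op.op (N.obj.map (A.homMk i a).op.op q) =
            f.hom.app _ (M.obj.map (A.homMk b (K a)).op.op m) := by
      obtain ⟨V, v, hxV, m, hm⟩ := Presheaf.imageSieve_mem A.topology f.hom q x (leOfHom i.unop hx)
      let j : V ⊓ d.base.unop ⟶ d.base.unop := homOfLE inf_le_right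
      obtain ⟨K₁, hK₁⟩ := A.exists_linear_comp i (A.toRestrict d j)
      obtain ⟨K₂, hK₂⟩ := A.exists_linear_fac (e := A.restrict d j) v (homOfLE inf_le_left)
        (i ≫ (A.toRestrict d j).base)
      refine ⟨_, j, A.restrict c v, _, K₂ ∘ₗ K₁, m, ⟨hxV, hx⟩, fun a => ?_⟩
      have e₁ : A.homMk i a ≫ A.toRestrict d j = A.toRestrict c v ≫ _ :=
        (hK₁ a).trans (hK₂ _).symm
      calc N.obj.map (A.toRestrict d j).op.op (N.obj.map (A.homMk i a).op.op q)
          = N.obj.map (A.homMk i a ≫ A.toRestrict d j).op.op q := by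
            rw [op_comp, op_comp, Functor.map_comp]; rfl
        _ = _ := by rw [e₁, op_comp, op_comp, Functor.map_comp]; rfl
        _ = N.obj.map _ (f.hom.app _ m) := congrArg _ hm.symm
        _ = _ := (NatTrans.naturality_apply f.hom _ m).symm
    constructor
    · intro c d i a b
      ext q
      refine A.eq_of_locally_eq N _ _ fun x hx => ?_
      obtain ⟨W, j, e, b', K, m, hxW, hK⟩ := key i q x hx
      refine ⟨W, j, hxW, ?_⟩
      have hM' : A.IsLinear M.obj := hM
      simp [hK, hM'.map_add]
    · intro c d i r a
      ext q
      refine A.eq_of_locally_eq N _ _ fun x hx => ?_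
      obtain ⟨W, j, e, b', K, m, hxW, hK⟩ := key i q x hx
      refine ⟨W, j, hxW, ?_⟩
      have hM' : A.IsLinear M.obj := hM
      simp [hK, hM'.map_smul]

instance (J : Type) [Category.{0} J] : A.isModule.IsClosedUnderLimitsOfShape J where
  limitsOfShape_le := by
    rintro M ⟨p⟩
    have hp (c) := isLimitOfPreserves (sheafToPresheaf A.topology (ModuleCat.{0} R) ⋙
      (evaluation _ _).obj c) p.isLimit
    have hn (j : J) {c d : A.Siteᵒᵖ} (f : c ⟶ d) : M.obj.map f ≫ (p.π.app j).hom.app d =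
        (p.π.app j).hom.app c ≫ (p.diag.obj j).obj.map f := (p.π.app j).hom.naturality f
    constructor
    · intro c d i a b
      refine (hp _).hom_ext fun j => ?_
      have hj : A.IsLinear (p.diag.obj j).obj := p.prop_diag_obj j
      change _ ≫ (p.π.app j).hom.app _ = _ ≫ (p.π.app j).hom.app _
      rw [hn, Preadditive.add_comp, hn, hn, ← Preadditive.comp_add, ← hj.map_add]
    · intro c d i r a
      refine (hp _).hom_ext fun j => ?_
      have hj : A.IsLinear (p.diag.obj j).obj := p.prop_diag_obj j
      change _ ≫ (p.π.app j).hom.app _ = _ ≫ (p.π.app j).hom.app _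
      rw [hn, Linear.smul_comp, hn, ← Linear.comp_smul, ← hj.map_smul]

instance : A.isModule.IsClosedUnderFiniteProducts where

instance : A.isModule.ContainsZero where
  exists_zero := ⟨⊤_ _, (isZero_zero _).of_iso (HasZeroObject.zeroIsoTerminal).symm, A.isModule.prop_terminal⟩

/-- The category `Mod(𝒜)` of (left) modules over the algebroid stack `𝒜`, that is, of `R`-linear
functors of stacks `M` from `𝒜` to the stack `V ↦ Mod(R_V)` of sheaves of `R`-modules.
Such an `M` is recorded through the groups of sections `(U, σ) ↦ Γ(U; M(σ))`. They are functorial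
for restrictions (as `M(σ|_V) = M(σ)|_V`) and for morphisms `σ ⟶ τ` in `𝒜(U)`, `R`-linearly in
the latter, and `V ↦ Γ(V; M(σ|_V))` is the sheaf `M(σ)` on `U`; these data determine `M`.
When `𝒜` is the algebroid stack of a sheaf of `R`-algebras, this is the category of left modules
over that sheaf. -/
abbrev Mod : Type 1 := A.isModule.FullSubcategory

instance : Abelian A.Mod := inferInstance

/-- The `R`-module of morphisms from `c = (U, σ)` to `d = (V, τ)`: it is `Hom(σ|_V, τ)` if `V ⊆ U`,
and `0` otherwise (there is at most one index `i`). -/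
def homModule (c d : A.Total) : Type :=
  ⨁ i : c.base ⟶ d.base, ((A.F.map i.toLoc).toFunctor.obj c.fiber ⟶ d.fiber)

instance (c d : A.Total) : AddCommGroup (A.homModule c d) :=
  inferInstanceAs (AddCommGroup
    (⨁ i : c.base ⟶ d.base, ((A.F.map i.toLoc).toFunctor.obj c.fiber ⟶ d.fiber)))

instance (c d : A.Total) : Module R (A.homModule c d) :=
  inferInstanceAs (Module R
    (⨁ i : c.base ⟶ d.base, ((A.F.map i.toLoc).toFunctor.obj c.fiber ⟶ d.fiber)))

/-- The inclusion of the summand of index `i`. -/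
def ι {c d : A.Total} (i : c.base ⟶ d.base) :
    ((A.F.map i.toLoc).toFunctor.obj c.fiber ⟶ d.fiber) →ₗ[R] A.homModule c d :=
  DirectSum.lof R (c.base ⟶ d.base)
    (fun i => ((A.F.map i.toLoc).toFunctor.obj c.fiber ⟶ d.fiber)) i

/-- A morphism of the total category as an element of `homModule`. -/
def single {c d : A.Total} (f : c ⟶ d) : A.homModule c d := A.ι f.base f.fiber

/-- The linear map out of `homModule` with the given components. -/
def desc {c d : A.Total} {N : Type} [AddCommGroup N] [Module R N]
    (φ : ∀ i : c.base ⟶ d.base, ((A.F.map i.toLoc).toFunctor.obj c.fiber ⟶ d.fiber) →ₗ[R] N) :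
    A.homModule c d →ₗ[R] N :=
  DirectSum.toModule R _ N φ

@[simp]
lemma desc_single {c d : A.Total} {N : Type} [AddCommGroup N] [Module R N]
    (φ : ∀ i : c.base ⟶ d.base, ((A.F.map i.toLoc).toFunctor.obj c.fiber ⟶ d.fiber) →ₗ[R] N)
    (f : c ⟶ d) : A.desc φ (A.single f) = φ f.base f.fiber := by
  exact DirectSum.toModule_lof R _ _

lemma homModule_ext {c d : A.Total} {N : Type} [AddCommGroup N] [Module R N]
    {φ ψ : A.homModule c d →ₗ[R] N} (h : ∀ f : c ⟶ d, φ (A.single f) = ψ (A.single f)) :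
    φ = ψ := by
  refine DirectSum.linearMap_ext (M := fun i : c.base ⟶ d.base =>
    ((A.F.map i.toLoc).toFunctor.obj c.fiber ⟶ d.fiber)) R fun i => ?_
  ext a
  exact h (A.homMk i a)

/-- Composition with `g` on the target side. -/
def postcomp (c : A.Total) {d e : A.Total} (g : d ⟶ e) : A.homModule c d →ₗ[R] A.homModule c e :=
  A.desc fun i => A.ι (i ≫ g.base) ∘ₗ
    Linear.leftComp R _ ((A.F.mapComp i.toLoc g.base.toLoc).hom.toNatTrans.app c.fiber) ∘ₗ
    Linear.rightComp R _ g.fiber ∘ₗ (A.F.map g.base.toLoc).toFunctor.mapLinearMap R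

/-- Composition with `g` on the source side. -/
def precomp {b c : A.Total} (g : b ⟶ c) (d : A.Total) : A.homModule c d →ₗ[R] A.homModule b d :=
  A.desc fun i => A.ι (g.base ≫ i) ∘ₗ
    Linear.leftComp R _ ((A.F.mapComp g.base.toLoc i.toLoc).hom.toNatTrans.app b.fiber ≫
      (A.F.map i.toLoc).toFunctor.map g.fiber)

@[simp]
lemma postcomp_single {c d e : A.Total} (f : c ⟶ d) (g : d ⟶ e) :
    A.postcomp c g (A.single f) = A.single (f ≫ g) := by
  rw [postcomp, desc_single]; rfl

@[simp]
lemma precomp_single {b c d : A.Total} (g : b ⟶ c) (f : c ⟶ d) :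
    A.precomp g d (A.single f) = A.single (g ≫ f) := by
  rw [precomp, desc_single]
  exact congrArg (A.ι (g.base ≫ f.base)) (Category.assoc _ _ _)

/-- `𝒜` as a bimodule over itself. For `c = (U, τ)` the functor `A.bimodule.obj c` is the presheaf
whose sections over `(V, σ)` are `Hom(τ|_V, σ)` if `V ⊆ U` and `0` otherwise; so it is the extension
by zero of the left `𝒜|_U`-module `𝒜(τ, ·)`. -/
def bimodule : A.Site ⥤ A.Siteᵒᵖ ⥤ ModuleCat.{0} R where
  obj c :=
    { obj d := ModuleCat.of R (A.homModule c.unop d.unop.unop)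
      map g := ModuleCat.ofHom (A.postcomp c.unop g.unop.unop)
      map_id d := by
        ext1; exact A.homModule_ext fun f => by simp
      map_comp g h := by
        ext1; exact A.homModule_ext fun f => by simp }
  map g :=
    { app d := ModuleCat.ofHom (A.precomp g.unop d.unop.unop)
      naturality d e h := by
        ext1; exact A.homModule_ext fun f => by simp }
  map_id c := by
    ext d : 3; exact A.homModule_ext fun f => by simp
  map_comp g h := by
    ext d : 3; exact A.homModule_ext fun f => by simp

variable (L : ModuleCat.{0} R)

/-- The bimodule `L ⊗_R 𝒜` (as a presheaf). -/
def tensorBimodule : A.Site ⥤ A.Siteᵒᵖ ⥤ ModuleCat.{0} R :=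
  A.bimodule ⋙ (Functor.whiskeringRight _ _ _).obj (MonoidalCategory.tensorLeft L)

/-- `ℋom_𝒜(L ⊗_R 𝒜, N)`: its sections over `(U, τ)` are the morphisms from the extension by zero of
the `𝒜|_U`-module `L ⊗_R 𝒜(τ, ·)` to `N`, i.e. the morphisms of `𝒜|_U`-modules from
`L ⊗_R 𝒜(τ, ·)` to `N|_U`. It is an `𝒜`-module through the contravariant dependence of `𝒜(τ, ·)`
on `τ`. (If `N` is a sheaf, it makes no difference whether `L ⊗_R 𝒜(τ, ·)` is sheafified.) -/
def homFunctor : (A.Siteᵒᵖ ⥤ ModuleCat.{0} R) ⥤ (A.Siteᵒᵖ ⥤ ModuleCat.{0} R) :=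
  linearYoneda R _ ⋙ (Functor.whiskeringLeft _ _ _).obj (A.tensorBimodule L).op


/-- The element `l ⊗ f`. -/
def tmul {c : A.Site} {d : A.Siteᵒᵖ} (l : L) (f : c.unop ⟶ d.unop.unop) :
    ((A.tensorBimodule L).obj c).obj d :=
  (TensorProduct.tmul R l (A.single f) :
    TensorProduct R L (A.homModule c.unop d.unop.unop))

lemma tensorBimodule_obj_map_tmul (c : A.Site) {d e : A.Siteᵒᵖ} (g : d ⟶ e)
    (l : L) (f : c.unop ⟶ d.unop.unop) :
    ((A.tensorBimodule L).obj c).map g (A.tmul L l f) = A.tmul L l (f ≫ g.unop.unop) :=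
  congrArg (TensorProduct.tmul R l) (A.postcomp_single f g.unop.unop)

lemma tensorBimodule_map_app_tmul {b c : A.Site} (g : b ⟶ c) (d : A.Siteᵒᵖ)
    (l : L) (f : b.unop ⟶ d.unop.unop) :
    ((A.tensorBimodule L).map g).app d (A.tmul L l f) = A.tmul L l (g.unop ≫ f) :=
  congrArg (TensorProduct.tmul R l) (A.precomp_single g.unop f)

lemma tensorBimodule_ext {c : A.Site} {d : A.Siteᵒᵖ} {N : ModuleCat.{0} R}
    {φ ψ : ((A.tensorBimodule L).obj c).obj d ⟶ N}
    (h : ∀ (l : L) (f : c.unop ⟶ d.unop.unop), φ (A.tmul L l f) = ψ (A.tmul L l f)) :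
    φ = ψ := by
  ext1
  refine TensorProduct.ext (LinearMap.ext fun l => ?_)
  exact A.homModule_ext fun f => h l f

lemma precomp_homMk_add {c d : A.Total} (i : c.base ⟶ d.base)
    (a b : (A.F.map i.toLoc).toFunctor.obj c.fiber ⟶ d.fiber) (e : A.Total) :
    A.precomp (A.homMk i (a + b)) e = A.precomp (A.homMk i a) e + A.precomp (A.homMk i b) e := by
  refine A.homModule_ext fun f => ?_
  obtain ⟨K, hK⟩ := A.exists_linear_comp i f
  rw [LinearMap.add_apply, precomp_single, precomp_single, precomp_single, hK, hK, hK, map_add]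
  exact map_add (A.ι _) _ _

lemma precomp_homMk_smul {c d : A.Total} (i : c.base ⟶ d.base) (r : R)
    (a : (A.F.map i.toLoc).toFunctor.obj c.fiber ⟶ d.fiber) (e : A.Total) :
    A.precomp (A.homMk i (r • a)) e = r • A.precomp (A.homMk i a) e := by
  refine A.homModule_ext fun f => ?_
  obtain ⟨K, hK⟩ := A.exists_linear_comp i f
  rw [LinearMap.smul_apply, precomp_single, precomp_single, hK, hK, map_smul]
  exact map_smul (A.ι _) _ _

lemma isLinear_homFunctor (N : A.Siteᵒᵖ ⥤ ModuleCat.{0} R) :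
    A.IsLinear ((A.homFunctor L).obj N) where
  map_add {c d} i a b := by
    have : (A.tensorBimodule L).map (A.homMk i (a + b)).op =
        (A.tensorBimodule L).map (A.homMk i a).op + (A.tensorBimodule L).map (A.homMk i b).op := by
      ext e : 2
      refine A.tensorBimodule_ext L fun l f => ?_
      change TensorProduct.tmul R l (A.precomp (A.homMk i (a + b)) _ (A.single f)) =
        TensorProduct.tmul R l (A.precomp (A.homMk i a) _ (A.single f)) +
        TensorProduct.tmul R l (A.precomp (A.homMk i b) _ (A.single f))
      rw [precomp_homMk_add, LinearMap.add_apply, TensorProduct.tmul_add]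
    ext f
    change (A.tensorBimodule L).obj (op c) ⟶ N at f
    exact (congrArg (· ≫ f) this).trans (Preadditive.add_comp _ _ _ _ _ _)
  map_smul {c d} i r a := by
    have : (A.tensorBimodule L).map (A.homMk i (r • a)).op =
        r • (A.tensorBimodule L).map (A.homMk i a).op := by
      ext e : 2
      refine A.tensorBimodule_ext L fun l f => ?_
      change TensorProduct.tmul R l (A.precomp (A.homMk i (r • a)) _ (A.single f)) =
        r • TensorProduct.tmul R l (A.precomp (A.homMk i a) _ (A.single f))
      rw [precomp_homMk_smul, LinearMap.smul_apply, TensorProduct.tmul_smul]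
    ext f
    change (A.tensorBimodule L).obj (op c) ⟶ N at f
    exact (congrArg (· ≫ f) this).trans (Linear.smul_comp _ _ _ _ _ _)

/-- The map `l ↦ l ⊗ 𝟙`. -/
def unitMap (c : A.Siteᵒᵖ) : L ⟶ ((A.tensorBimodule L).obj c.unop).obj c :=
  ModuleCat.ofHom ((TensorProduct.mk R L (A.homModule c.unop.unop c.unop.unop)).flip
    (A.single (𝟙 c.unop.unop)))

/-- Evaluation at the identities. -/
def evalAtUnit (N : A.Siteᵒᵖ ⥤ ModuleCat.{0} R) : (A.homFunctor L).obj N ⟶ N ⋙ ihom L where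
  app c := ModuleCat.ofHom
    { toFun f := A.unitMap L c ≫ NatTrans.app (show (A.tensorBimodule L).obj c.unop ⟶ N from f) c
      map_add' f g := Preadditive.comp_add _ _ _ _ _ _
      map_smul' r f := Linear.comp_smul _ _ _ _ _ _ }
  naturality c d g := by
    ext f
    change A.unitMap L d ≫ ((A.tensorBimodule L).map g.unop).app d ≫ NatTrans.app f d =
      (A.unitMap L c ≫ NatTrans.app f c) ≫ N.map g
    change (A.tensorBimodule L).obj c.unop ⟶ N at f
    rw [Category.assoc, ← f.naturality, ← Category.assoc, ← Category.assoc]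
    congr 1
    ext l
    refine (A.tensorBimodule_map_app_tmul L g.unop d l (𝟙 _)).trans
      (Eq.trans ?_ (A.tensorBimodule_obj_map_tmul L c.unop g l (𝟙 _)).symm)
    rw [Category.comp_id, Category.id_comp]

variable {A} in
lemma isIso_evalAtUnit {N : A.Siteᵒᵖ ⥤ ModuleCat.{0} R} (hN : A.IsLinear N) :
    IsIso (A.evalAtUnit L N) := by
  rw [NatTrans.isIso_iff_isIso_app]
  intro c
  rw [ConcreteCategory.isIso_iff_bijective]
  constructor
  · intro f g h
    change (A.tensorBimodule L).obj c.unop ⟶ N at f g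
    change A.unitMap L c ≫ f.app c = A.unitMap L c ≫ g.app c at h
    refine NatTrans.ext (funext fun d => ?_)
    refine A.tensorBimodule_ext L fun l k => ?_
    have hk := A.tensorBimodule_obj_map_tmul L c.unop (d := c) (e := d) k.op.op l (𝟙 _)
    rw [Category.id_comp] at hk
    change _ = A.tmul L l k at hk
    rw [← hk]
    refine (NatTrans.naturality_apply f _ _).trans
      (Eq.trans (congrArg _ ?_) (NatTrans.naturality_apply g _ _).symm)
    exact congrArg (fun t : L ⟶ N.obj c => t l) h
  · intro ψ
    change L ⟶ N.obj c at ψ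
    let Φ (d : A.Siteᵒᵖ) : A.homModule c.unop.unop d.unop.unop →ₗ[R] L →ₗ[R] N.obj d :=
      A.desc fun i =>
        { toFun a := (N.map (A.homMk i a).op.op).hom ∘ₗ ψ.hom
          map_add' a b := by rw [hN.map_add]; rfl
          map_smul' r a := by rw [hN.map_smul]; rfl }
    have hΦ (d : A.Siteᵒᵖ) (f : c.unop.unop ⟶ d.unop.unop) (l : L) :
        Φ d (A.single f) l = N.map f.op.op (ψ l) := by
      simp only [Φ, desc_single]; rfl
    let f : (A.tensorBimodule L).obj c.unop ⟶ N :=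
      { app d := ModuleCat.ofHom (TensorProduct.lift (Φ d).flip)
        naturality d e g := by
          refine A.tensorBimodule_ext L fun l k => ?_
          refine (congrArg (TensorProduct.lift (Φ e).flip)
            (A.tensorBimodule_obj_map_tmul L c.unop g l k)).trans ?_
          change Φ e (A.single (k ≫ g.unop.unop)) l = N.map g (Φ d (A.single k) l)
          rw [hΦ, hΦ, op_comp, op_comp, Functor.map_comp]
          rfl }
    refine ⟨f, ?_⟩
    change A.unitMap L c ≫ f.app c = ψ
    ext l
    change Φ c (A.single (𝟙 _)) l = ψ l
    rw [hΦ, op_id, op_id]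
    exact congrArg (fun t : N.obj c ⟶ N.obj c => t (ψ l)) (N.map_id c)

lemma isSheaf_homFunctor (N : A.Mod) :
    Presheaf.IsSheaf A.topology ((A.homFunctor L).obj N.obj.obj) := by
  have := isIso_evalAtUnit L N.property
  have : PreservesLimits (ihom L) := (ihom.adjunction L).rightAdjoint_preservesLimits
  exact (Presheaf.isSheaf_of_iso_iff (asIso (A.evalAtUnit L N.obj.obj))).2
    (Presheaf.isSheaf_comp_of_isSheaf A.topology N.obj.obj (ihom L) N.obj.property)

/-- The left exact functor `ℋom_𝒜(L ⊗_R 𝒜, ·) : Mod(𝒜) ⥤ Mod(𝒜)`. -/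
def homMod : A.Mod ⥤ A.Mod :=
  A.isModule.lift (ObjectProperty.lift _
    (A.isModule.ι ⋙ sheafToPresheaf _ _ ⋙ A.homFunctor L) fun N => A.isSheaf_homFunctor L N)
    fun N => A.isLinear_homFunctor L N.obj.obj

instance : (A.homMod L).Additive where
  map_add {M N f g} := by
    refine A.isModule.hom_ext (ObjectProperty.hom_ext _ (NatTrans.ext (funext fun c => ?_)))
    ext h
    exact Preadditive.comp_add (C := A.Siteᵒᵖ ⥤ ModuleCat.{0} R) _ _ _ h f.hom.hom g.hom.hom

/-- `N` is a value at `M` of the right derived functor `Rℋom_𝒜(L ⊗_R 𝒜, ·) : D(𝒜) → D(𝒜)` of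
`ℋom_𝒜(L ⊗_R 𝒜, ·)`: for a K-injective complex `I` representing `M`, the complex
`ℋom_𝒜(L ⊗_R 𝒜, I)` represents `N`. -/
def IsRHom [HasDerivedCategory.{w} A.Mod] (M N : DerivedCategory A.Mod) : Prop :=
  ∃ I : CochainComplex A.Mod ℤ, I.IsKInjective ∧ Nonempty (DerivedCategory.Q.obj I ≅ M) ∧
    Nonempty (DerivedCategory.Q.obj
      (((A.homMod L).mapHomologicalComplex (ComplexShape.up ℤ)).obj I) ≅ N)

/-- Over `W ⊆ U`, the endomorphisms of the restriction of `σ ∈ 𝒜(U)`. -/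
abbrev EndSec {U W : Opens X} (σ : A.F.obj (.mk (op U))) (h : W ≤ U) : Type :=
  (A.F.map (homOfLE h).op.toLoc).toFunctor.obj σ ⟶ (A.F.map (homOfLE h).op.toLoc).toFunctor.obj σ

/-- The restriction maps of the sheaf `ℰnd(σ)`. -/
def resEnd {U W W' : Opens X} (σ : A.F.obj (.mk (op U))) (h : W ≤ U) (h' : W' ≤ W)
    (a : A.EndSec σ h) : A.EndSec σ (h'.trans h) :=
  Pseudofunctor.LocallyDiscreteOpToCat.pullHom a (homOfLE h') (homOfLE (h'.trans h))
    (homOfLE (h'.trans h)) (Subsingleton.elim _ _) (Subsingleton.elim _ _)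

end Algebroid

/-- An isomorphism of sheaves of `ℂ⟦ħ⟧`-algebras over `V ⊆ U` from a star algebra `(𝒪⟦ħ⟧, ⋆)` to
`ℰnd(σ)`, where `σ ∈ 𝒜(U)`. -/
structure StarIso {X : CAlgSpace} (A : Algebroid ℂ⟦X⟧ X.space) {U V : Opens X.space}
    (σ : A.F.obj (.mk (op U))) (hV : V ≤ U) where
  star : StarProduct X V
  φ : ∀ (W : Opens X.space) (hW : W ≤ V), (X.Sec W)⟦X⟧ ≃ₗ[ℂ⟦X⟧] A.EndSec σ (hW.trans hV)
  map_res : ∀ (W W' : Opens X.space) (hW : W ≤ V) (h : W' ≤ W) (f : (X.Sec W)⟦X⟧),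
    φ W' (h.trans hW) (PowerSeries.map (X.res h) f) = A.resEnd σ (hW.trans hV) h (φ W hW f)
  map_one : ∀ (W : Opens X.space) (hW : W ≤ V), φ W hW 1 = 𝟙 _
  map_mul : ∀ (W : Opens X.space) (hW : W ≤ V) (f g : (X.Sec W)⟦X⟧),
    φ W hW (star.mul hW f g) = φ W hW g ≫ φ W hW f

/-- A DQ-algebroid on `X`: a `ℂ⟦ħ⟧`-algebroid stack such that for every local object `σ`, the sheaf
of `ℂ⟦ħ⟧`-algebras `ℰnd(σ)` is a DQ-algebra, i.e. locally isomorphic to a star algebra. -/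
structure DQAlgebroid (X : SmoothComplexVariety) extends
    Algebroid ℂ⟦X⟧ X.toCAlgSpace.space where
  isDQ : ∀ (U : Opens X.toCAlgSpace.space) (σ : F.obj (.mk (op U))) (x : X.toCAlgSpace.space),
    x ∈ U → ∃ (V : Opens X.toCAlgSpace.space) (hV : V ≤ U), x ∈ V ∧
      Nonempty (StarIso toAlgebroid σ hV)

namespace DQAlgebroid

variable {X : SmoothComplexVariety} (A : DQAlgebroid X)

/-- The category `Mod(𝒜_X)`. -/
abbrev Mod : Type 1 := A.toAlgebroid.Mod

/-- `N` is a value at `M` of `Rℋom_{𝒜_X}(𝒜_X^loc, ·) : D(𝒜_X) → D(𝒜_X)`, where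
`𝒜_X^loc = ℂ((ħ)) ⊗_{ℂ⟦ħ⟧} 𝒜_X`. -/
def IsRHomLoc [HasDerivedCategory.{w} A.Mod] (M N : DerivedCategory A.Mod) : Prop :=
  A.toAlgebroid.IsRHom (ModuleCat.of ℂ⟦X⟧ ℂ⸨X⸩) M N

end DQAlgebroid

end DQ

end

/-! Represent `M` by a K-injective complex `I` with cohomology zero above degree `b`. Then `N` is
represented by `ℋom(L ⊗ 𝒜, I)` with `L = ℂ((ħ))`, whose sections over `c` are the maps from `L` to
the sections of `I` over `c`. Two facts bound its cohomology.

The topological fact is `locallyVanishing`: there is a number `d`, depending only on the space, such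
that each point of an open set `U` has a neighbourhood `V` in `U` on which all cocycles of `I` over
`U` of degree larger than `b + d` become coboundaries, with one `V` for all of them. Its only inputs
are local exactness and Mayer-Vietoris. For schemes the proof is Grothendieck's induction on
codimension (`null_of_noetherian`); for manifolds a compact neighbourhood is sliced along `2n` real
coordinates (`exists_null_of_isCompact`).

The algebraic fact is that `L`, the colimit of `R → R → ⋯` with transition maps `ħ`, has the free
resolution `R^(ℕ) → R^(ℕ)` of length one (`telescope_exact`). A cocycle `L → Iʲ` yields a sequence
of cocycles. Since `V` is uniform, they all become coboundaries at once; the failure of the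
primitives to descend to `L` is a sequence of cocycles of degree `j - 1`, killed on a smaller `W`.
K-injectivity then produces a primitive on `L` (`exactAt_homMod`). So the cohomology vanishes above
`b + d + 1`.

K-injectivity enters only through `exists_comp_d_eq`, applied to two kinds of short exact sequences:
Mayer-Vietoris sequences of extensions by zero, and the telescope tensored with `𝒜`. -/

noncomputable section

namespace DQ

/-! ### Short exact sequences and maps into K-injective complexes. -/

section KInjective

variable {C : Type*} [Category* C] [Abelian C]

/-- The terms of the complex `S.X₁ ⟶ S.X₂ ⟶ S.X₃` placed in degrees `-2`, `-1`, `0`. -/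
def threeTermX (S : ShortComplex C) : ℤ → C
  | .ofNat 0 => S.X₃
  | .negSucc 0 => S.X₂
  | .negSucc 1 => S.X₁
  | .ofNat (_ + 1) => 0
  | .negSucc (_ + 2) => 0

/-- The differentials of the complex `S.X₁ ⟶ S.X₂ ⟶ S.X₃` placed in degrees `-2`, `-1`, `0`. -/
def threeTermD (S : ShortComplex C) : ∀ n : ℤ, threeTermX S n ⟶ threeTermX S (n + 1)
  | .negSucc 0 => S.g
  | .negSucc 1 => S.f
  | .ofNat _ => 0
  | .negSucc (_ + 2) => 0

/-- The complex `S.X₁ ⟶ S.X₂ ⟶ S.X₃` placed in degrees `-2`, `-1`, `0`. -/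
def threeTerm (S : ShortComplex C) : CochainComplex C ℤ :=
  CochainComplex.of (threeTermX S) (threeTermD S) (by
    rintro (n | _ | _ | n)
    · exact zero_comp
    · exact comp_zero
    · exact S.zero
    · exact zero_comp)

lemma threeTerm_d (S : ShortComplex C) (n : ℤ) : (threeTerm S).d n (n + 1) = threeTermD S n :=
  CochainComplex.of_d _ _ _

lemma acyclic_threeTerm {S : ShortComplex C} (hS : S.ShortExact) : (threeTerm S).Acyclic := by
  have hz (n : ℤ) (hn : IsZero (threeTermX S n)) : (threeTerm S).ExactAt n :=
    ShortComplex.exact_of_isZero_X₂ _ hn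
  -- `Int.negSucc m` is the degree `-(m + 1)`. Degrees `0`, `-1`, `-2` use respectively that `g` is
  -- epi, exactness in the middle, and that `f` is mono.
  rintro ((_ | n) | (_ | _ | n))
  · refine (HomologicalComplex.exactAt_iff' (threeTerm S) (Int.negSucc 0) (Int.ofNat 0) (Int.ofNat 1)
      (by simp) (by simp)).2 ?_
    refine (ShortComplex.exact_iff_epi _ ?_).2 ?_
    · exact (threeTerm_d S (.ofNat 0)).trans rfl
    · have := hS.epi_g
      rwa [← show (threeTerm S).d (.negSucc 0) (.ofNat 0) = S.g from threeTerm_d S (.negSucc 0)] at this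
  · exact hz _ (isZero_zero C)
  · refine (HomologicalComplex.exactAt_iff' (threeTerm S) (Int.negSucc 1) (Int.negSucc 0) (Int.ofNat 0)
      (by simp) (by simp)).2 ?_
    have h₁ : (threeTerm S).d (.negSucc 1) (.negSucc 0) = S.f := threeTerm_d S (.negSucc 1)
    have h₂ : (threeTerm S).d (.negSucc 0) (.ofNat 0) = S.g := threeTerm_d S (.negSucc 0)
    refine (ShortComplex.exact_iff_of_iso ?_).1 hS.exact
    exact ShortComplex.isoMk (Iso.refl _) (Iso.refl _) (Iso.refl _)
      ((Category.id_comp _).trans (h₁.trans (Category.comp_id S.f).symm))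
      ((Category.id_comp _).trans (h₂.trans (Category.comp_id S.g).symm))
  · refine (HomologicalComplex.exactAt_iff' (threeTerm S) (Int.negSucc 2) (Int.negSucc 1) (Int.negSucc 0)
      (by simp) (by simp)).2 ?_
    refine (ShortComplex.exact_iff_mono _ ?_).2 ?_
    · exact (threeTerm_d S (.negSucc 2)).trans rfl
    · have := hS.mono_f
      rwa [← show (threeTerm S).d (.negSucc 1) (.negSucc 0) = S.f from threeTerm_d S (.negSucc 1)] at this
  · exact hz _ (isZero_zero C)

/-- Maps from the terms of `S` which form a morphism from the three-term complex. -/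
def threeTermDesc {K : CochainComplex C ℤ} {S : ShortComplex C} (φ : S.X₃ ⟶ K.X 0)
    (ψ : S.X₂ ⟶ K.X (-1)) (χ : S.X₁ ⟶ K.X (-2)) (hφ : φ ≫ K.d 0 1 = 0)
    (hψ : S.g ≫ φ = ψ ≫ K.d (-1) 0) (hχ : S.f ≫ ψ = χ ≫ K.d (-2) (-1)) :
    threeTerm S ⟶ K :=
  CochainComplex.ofHom (fun
    | .ofNat 0 => φ
    | .negSucc 0 => ψ
    | .negSucc 1 => χ
    | .ofNat (_ + 1) => 0
    | .negSucc (_ + 2) => 0) (by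
    intro n
    rw [threeTerm_d]
    obtain ((_ | n) | (_ | _ | _ | n)) := n
    · exact hφ.trans zero_comp.symm
    · exact zero_comp.trans zero_comp.symm
    · exact hψ.symm
    · exact hχ.symm
    · exact zero_comp.trans zero_comp.symm
    · exact zero_comp.trans zero_comp.symm)

/-- A class with values in a K-injective complex vanishes if it vanishes on the middle term of a
short exact sequence, in a way which is compatible with the first term. -/
lemma exists_comp_d_eq {I : CochainComplex C ℤ} (hI : I.IsKInjective) {S : ShortComplex C}
    (hS : S.ShortExact) {h i j k : ℤ} (hi : h + 1 = i) (hj : i + 1 = j) (hk : j + 1 = k)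
    (φ : S.X₃ ⟶ I.X j) (ψ : S.X₂ ⟶ I.X i) (χ : S.X₁ ⟶ I.X h) (hφ : φ ≫ I.d j k = 0)
    (hψ : S.g ≫ φ = ψ ≫ I.d i j) (hχ : S.f ≫ ψ = χ ≫ I.d h i) :
    ∃ θ : S.X₃ ⟶ I.X i, θ ≫ I.d i j = φ := by
  -- Shifting by `n = j` moves the problem to degrees `-2`, `-1`, `0`, where the three-term complex
  -- lives.
  obtain ⟨n, rfl⟩ : ∃ n, j = 0 + n := ⟨j, (zero_add j).symm⟩
  obtain rfl : i = -1 + n := by omega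
  obtain rfl : h = -2 + n := by omega
  obtain rfl : k = 1 + n := by omega
  have hd (p q : ℤ) : (I⟦n⟧).d p q = n.negOnePow • I.d (p + n) (q + n) := rfl
  have e₁ : φ ≫ (n.negOnePow • I.d (0 + n) (1 + n)) = 0 := by
    rw [Linear.comp_units_smul, hφ, smul_zero]
  have e₂ : S.g ≫ φ = (n.negOnePow • ψ) ≫ (n.negOnePow • I.d (-1 + n) (0 + n)) := by
    rw [Linear.comp_units_smul, Linear.units_smul_comp, smul_smul, Int.units_mul_self, one_smul, hψ]
  have e₃ : S.f ≫ (n.negOnePow • ψ) = χ ≫ (n.negOnePow • I.d (-2 + n) (-1 + n)) := by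
    rw [Linear.comp_units_smul, Linear.comp_units_smul, hχ]
  -- The differential of `I⟦n⟧` carries the sign `(-1)ⁿ`, which is absorbed by twisting `ψ` alone.
  let F : threeTerm S ⟶ I⟦n⟧ := threeTermDesc (K := I⟦n⟧) φ (n.negOnePow • ψ) χ e₁ e₂ e₃
  obtain ⟨H⟩ := CochainComplex.IsKInjective.nonempty_homotopy_zero F (acyclic_threeTerm hS)
  -- The three-term complex stops in degree `0`, so the homotopy identity there expresses `φ` as a
  -- primitive followed by the differential.
  have h0 := H.comm 0
  rw [dNext_eq _ (show (ComplexShape.up ℤ).Rel 0 1 from rfl),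
    prevD_eq _ (show (ComplexShape.up ℤ).Rel (-1) 0 from rfl)] at h0
  have hz : (threeTerm S).d 0 1 = 0 := threeTerm_d S 0
  rw [hz, zero_comp, zero_add, HomologicalComplex.zero_f, add_zero, hd] at h0
  let H' : S.X₃ ⟶ I.X (-1 + n) := H.hom 0 (-1)
  have h0' : φ = H' ≫ (n.negOnePow • I.d (-1 + n) (0 + n)) := h0
  exact ⟨n.negOnePow • H', by rw [h0', Linear.units_smul_comp, Linear.comp_units_smul]⟩

end KInjective

/-! ### Abstract vanishing theorems from Mayer-Vietoris. -/

/-- Graded classes on the open subsets of `Y` with a notion of vanishing, which satisfy the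
Mayer-Vietoris property and vanish locally in degrees larger than `b`. -/
structure MayerVietorisTheory (Y : Type) [TopologicalSpace Y] (b : ℤ) where
  Cls : ℤ → Opens Y → Type
  res {j : ℤ} {V W : Opens Y} (h : V ≤ W) (s : Cls j W) : Cls j V
  Null {j : ℤ} {W : Opens Y} (s : Cls j W) : Prop
  res_res {j : ℤ} {U V W : Opens Y} (h : U ≤ V) (h' : V ≤ W) (s : Cls j W) :
    res h (res h' s) = res (h.trans h') s
  res_self {j : ℤ} {W : Opens Y} (s : Cls j W) : res le_rfl s = s
  null_res {j : ℤ} {V W : Opens Y} (h : V ≤ W) (s : Cls j W) (hs : Null s) : Null (res h s)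
  null_bot {j : ℤ} (s : Cls j ⊥) : Null s
  locally_null {j : ℤ} (hj : b < j) {W : Opens Y} (s : Cls j W) (x : Y) (hx : x ∈ W) :
    ∃ (V : Opens Y) (h : V ≤ W), x ∈ V ∧ Null (res h s)
  -- The obstruction `u` is fixed before the shrinkings `V₁`, `V₂`, so that one can first find where
  -- `u` vanishes and then shrink accordingly.
  mayerVietoris {j : ℤ} {W₁ W₂ : Opens Y} (s : Cls (j + 1) (W₁ ⊔ W₂))
    (h₁ : Null (res le_sup_left s)) (h₂ : Null (res le_sup_right s)) :
    ∃ u : Cls j (W₁ ⊓ W₂), ∀ (V₁ V₂ : Opens Y) (h₁ : V₁ ≤ W₁) (h₂ : V₂ ≤ W₂),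
      Null (res (inf_le_inf h₁ h₂) u) → Null (res (sup_le_sup h₁ h₂) s)

namespace MayerVietorisTheory

variable {Y : Type} [TopologicalSpace Y] {b : ℤ} (T : MayerVietorisTheory Y b)

lemma null_of_le {j : ℤ} {U V W : Opens Y} {s : T.Cls j W} {hV : V ≤ W}
    (h : T.Null (T.res hV s)) (hUV : U ≤ V) : T.Null (T.res (hUV.trans hV) s) := by
  rw [← T.res_res hUV hV]
  exact T.null_res _ _ h

/-- The Mayer-Vietoris property for two open subsets of `W`. -/
lemma exists_obstruction {j : ℤ} {W W₁ W₂ : Opens Y} (s : T.Cls (j + 1) W) (h₁ : W₁ ≤ W)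
    (h₂ : W₂ ≤ W) (hs₁ : T.Null (T.res h₁ s)) (hs₂ : T.Null (T.res h₂ s)) :
    ∃ u : T.Cls j (W₁ ⊓ W₂), ∀ (V₁ V₂ : Opens Y) (hV₁ : V₁ ≤ W₁) (hV₂ : V₂ ≤ W₂)
      (V : Opens Y) (hV : V ≤ W₁ ⊓ W₂), V₁ ⊓ V₂ ≤ V → T.Null (T.res hV u) →
      T.Null (T.res (sup_le (hV₁.trans h₁) (hV₂.trans h₂)) s) := by
  obtain ⟨u, hu⟩ := T.mayerVietoris (T.res (sup_le h₁ h₂) s) (by rwa [T.res_res])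
    (by rwa [T.res_res])
  refine ⟨u, fun V₁ V₂ hV₁ hV₂ V hV hle hn => ?_⟩
  have := hu V₁ V₂ hV₁ hV₂ (T.null_of_le hn hle)
  rwa [T.res_res] at this

/-! ### Noetherian spaces: induction on codimension. -/

/-- In a quasi-sober Noetherian space, a point of the closure of a locally closed subset is a
specialization of a point of this subset. -/
lemma exists_specializes_of_mem_closure [NoetherianSpace Y] [QuasiSober Y] {U V : Opens Y} {x : Y}
    (hx : x ∈ closure ((U : Set Y) \ V)) : ∃ y ∈ (U : Set Y) \ V, y ⤳ x := by
  -- The closure has finitely many irreducible pieces, all disjoint from `V`, and finiteness lets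
  -- closure commute with their union.
  obtain ⟨S, hSf, hSc, hSi, hS⟩ := NoetherianSpace.exists_finite_set_isClosed_irreducible
    (isClosed_closure (s := (U : Set Y) \ V))
  have hSV : ∀ Z ∈ S, Z ⊆ (V : Set Y)ᶜ := fun Z hZ => (Set.subset_sUnion_of_mem hZ).trans
    (hS ▸ closure_minimal (fun y hy => hy.2) V.isOpen.isClosed_compl)
  have hsub : (U : Set Y) \ V ⊆ ⋃ Z ∈ S, Z ∩ U := fun y hy => by
    obtain ⟨Z, hZ, hyZ⟩ := hS ▸ subset_closure hy
    exact Set.mem_biUnion hZ ⟨hyZ, hy.1⟩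
  have hx' := closure_mono hsub hx
  rw [hSf.closure_biUnion, Set.mem_iUnion₂] at hx'
  obtain ⟨Z, hZ, hxZ⟩ := hx'
  -- The generic point of `Z` lies in every open set that meets `Z`, in particular in `U`, and
  -- specializes to all points of `Z`.
  obtain ⟨z, hz⟩ := QuasiSober.sober (hSi Z hZ) (hSc Z hZ)
  have hzU : z ∈ (U : Set Y) :=
    (hz.mem_open_set_iff U.isOpen).2 (closure_nonempty_iff.1 ⟨x, hxZ⟩)
  exact ⟨z, ⟨hzU, hSV Z hZ hz.mem⟩,
    hz.specializes ((hSc Z hZ).closure_subset_iff.2 Set.inter_subset_left hxZ)⟩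

/-- Vanishing outside of codimension `n`, in degrees larger than `b + n - 1`. -/
lemma exists_null_of_codim [NoetherianSpace Y] [QuasiSober Y] (codim : Y → ℕ)
    (hcodim : ∀ x y : Y, y ⤳ x → y ≠ x → codim y < codim x) (n : ℕ) {j : ℤ} (hj : b + n ≤ j)
    {W : Opens Y} (s : T.Cls j W) :
    ∃ (V : Opens Y) (h : V ≤ W), T.Null (T.res h s) ∧ ∀ x ∈ W, x ∉ V → n ≤ codim x := by
  induction n generalizing j W with
  | zero => exact ⟨⊥, bot_le, T.null_bot _, fun _ _ _ => Nat.zero_le _⟩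
  | succ n ih =>
    -- Take a maximal open set in `P`. A point of codimension exactly `n` outside it will allow an
    -- enlargement within `P`, a contradiction.
    let P : Set (Opens Y) := {V | ∃ h : V ≤ W, T.Null (T.res h s) ∧ ∀ x ∈ W, x ∉ V → n ≤ codim x}
    have hP : P.Nonempty := by
      obtain ⟨V, hV⟩ := ih (j := j) (by push_cast at hj; omega) s
      exact ⟨V, hV⟩
    obtain ⟨V, ⟨hVW, hVs, hVn⟩, hmax⟩ :=
      (wellFounded_gt (α := Opens Y)).has_min P hP
    refine ⟨V, hVW, hVs, fun x hxW hxV => ?_⟩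
    by_contra hlt
    have hxn : codim x = n := le_antisymm (by omega) (hVn x hxW hxV)
    obtain ⟨j, rfl⟩ : ∃ i, j = i + 1 := ⟨j - 1, by ring⟩
    obtain ⟨U, hUW, hxU, hUs⟩ := T.locally_null (by push_cast at hj; omega) s x hxW
    -- The obstruction has degree one less, which is still enough for the induction hypothesis with
    -- `n`: it vanishes off a subset of codimension at least `n`.
    obtain ⟨u, hu⟩ := T.exists_obstruction s hVW hUW hVs hUs
    obtain ⟨V', hV', hV's, hV'n⟩ := ih (j := j) (by push_cast at hj; omega) u
    -- Otherwise a point `y ≠ x` of the bad locus would specialize to `x`; then `codim y < n`,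
    -- whereas that locus has codimension at least `n`.
    have hx : x ∉ closure (((V ⊓ U : Opens Y) : Set Y) \ V') := fun hx => by
      obtain ⟨y, ⟨hy, hyV'⟩, hyx⟩ := exists_specializes_of_mem_closure hx
      have h₁ := hV'n y hy hyV'
      have h₂ := hcodim x y hyx (fun h => hxV (h ▸ hy.1))
      omega
    let U' : Opens Y := U ⊓ ⟨_, (isClosed_closure (s := ((V ⊓ U : Opens Y) : Set Y) \ V')).isOpen_compl⟩
    have hU' : V ⊓ U' ≤ V' := fun y hy => by
      by_contra hyV'
      exact hy.2.2 (subset_closure ⟨⟨hy.1, hy.2.1⟩, hyV'⟩)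
    refine hmax (V ⊔ U') ⟨_, hu V U' le_rfl inf_le_left V' hV' hU' hV's, fun y hy hyV => ?_⟩ ?_
    · exact hVn y hy fun h => hyV (Or.inl h)
    · exact lt_of_le_of_ne le_sup_left fun h => hxV (h ▸ Or.inr ⟨hxU, hx⟩)

/-- On a quasi-sober Noetherian space of dimension less than `d`, classes of degree at least
`b + d` vanish. -/
lemma null_of_noetherian [NoetherianSpace Y] [QuasiSober Y] (codim : Y → ℕ)
    (hcodim : ∀ x y : Y, y ⤳ x → y ≠ x → codim y < codim x) (d : ℕ) (hd : ∀ x, codim x < d)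
    {j : ℤ} (hj : b + d ≤ j) {W : Opens Y} (s : T.Cls j W) : T.Null s := by
  obtain ⟨V, hV, hs, h⟩ := T.exists_null_of_codim codim hcodim d hj s
  obtain rfl : V = W := le_antisymm hV fun x hx => by
    by_contra hxV
    exact absurd (h x hx hxV) (not_le.2 (hd x))
  rwa [T.res_self] at hs

/-! ### Compact sets: slicing by continuous functions. -/

/-- Gluing the vanishing of a class along the level set of a continuous function. -/
lemma exists_null_union {j : ℤ} {W : Opens Y} (s : T.Cls (j + 1) W) {f : Y → ℝ} (hf : Continuous f)
    (t : ℝ) {K₁ K₂ : Set Y} (hK₁ : ∀ x ∈ K₁, f x ≤ t) (hK₂ : ∀ x ∈ K₂, t ≤ f x)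
    (hs₁ : ∃ (V : Opens Y) (h : V ≤ W), K₁ ⊆ V ∧ T.Null (T.res h s))
    (hs₂ : ∃ (V : Opens Y) (h : V ≤ W), K₂ ⊆ V ∧ T.Null (T.res h s)) {L : Set Y}
    (hL₁ : ∀ x ∈ K₁, f x = t → x ∈ L) (hL₂ : ∀ x ∈ K₂, f x = t → x ∈ L)
    (hLK₁ : L ⊆ K₁) (hLK₂ : L ⊆ K₂)
    (H : ∀ (U : Opens Y) (u : T.Cls j U), L ⊆ U → ∃ (V : Opens Y) (h : V ≤ U), L ⊆ V ∧
      T.Null (T.res h u)) :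
    ∃ (V : Opens Y) (h : V ≤ W), K₁ ∪ K₂ ⊆ V ∧ T.Null (T.res h s) := by
  obtain ⟨W₁, hW₁, hK₁W, hs₁⟩ := hs₁
  obtain ⟨W₂, hW₂, hK₂W, hs₂⟩ := hs₂
  obtain ⟨u, hu⟩ := T.exists_obstruction s hW₁ hW₂ hs₁ hs₂
  obtain ⟨V, hV, hLV, hVu⟩ := H _ u fun x hx => ⟨hK₁W (hLK₁ hx), hK₂W (hLK₂ hx)⟩
  -- Shrinking to `{f < t} ∪ V` on one side and to `{t < f} ∪ V` on the other leaves an overlap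
  -- contained in `V`, where the obstruction vanishes.
  let A₁ : Opens Y := ⟨{x | f x < t}, isOpen_lt hf continuous_const⟩
  let A₂ : Opens Y := ⟨{x | t < f x}, isOpen_lt continuous_const hf⟩
  refine ⟨_, _, ?_, hu (W₁ ⊓ (A₁ ⊔ V)) (W₂ ⊓ (A₂ ⊔ V)) inf_le_left inf_le_left V hV ?_ hVu⟩
  · rintro x (hx | hx)
    · refine Or.inl ⟨hK₁W hx, ?_⟩
      rcases (hK₁ x hx).lt_or_eq with h | h
      · exact Or.inl h
      · exact Or.inr (hLV (hL₁ x hx h))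
    · refine Or.inr ⟨hK₂W hx, ?_⟩
      rcases (hK₂ x hx).lt_or_eq with h | h
      · exact Or.inl h
      · exact Or.inr (hLV (hL₂ x hx h.symm))
  · rintro x ⟨⟨-, h₁ | h₁⟩, ⟨-, h₂ | h₂⟩⟩
    · exact (lt_irrefl _ (lt_trans (show f x < t from h₁) (show t < f x from h₂))).elim
    all_goals assumption

/-- Near a compact subset whose points are separated by `m` continuous functions, classes of degree
larger than `b + m` vanish. -/
lemma exists_null_of_isCompact (f : ℕ → Y → ℝ) (hf : ∀ i, Continuous (f i)) (m : ℕ) {j : ℤ}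
    (hj : b + m < j) {W : Opens Y} (s : T.Cls j W) {K : Set Y} (hK : IsCompact K) (hKW : K ⊆ W)
    (hsep : ∀ x ∈ K, ∀ y ∈ K, (∀ i < m, f i x = f i y) → x = y) :
    ∃ (V : Opens Y) (h : V ≤ W), K ⊆ V ∧ T.Null (T.res h s) := by
  induction m generalizing j W K with
  | zero =>
    rcases K.eq_empty_or_nonempty with rfl | ⟨x, hx⟩
    · exact ⟨⊥, bot_le, Set.empty_subset _, T.null_bot _⟩
    · obtain ⟨V, hV, hxV, hs⟩ := T.locally_null (by simpa using hj) s x (hKW hx)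
      refine ⟨V, hV, fun y hy => ?_, hs⟩
      rwa [hsep y hy x hx (by simp)]
  | succ m ih =>
    obtain ⟨j, rfl⟩ : ∃ i, j = i + 1 := ⟨j - 1, by ring⟩
    -- On a level set of `f m` the remaining `m` functions separate points, so the induction
    -- hypothesis applies one degree lower.
    have hslice (t : ℝ) {i : ℤ} (hi : b + m < i) (U : Opens Y) (u : T.Cls i U)
        (hU : K ∩ f m ⁻¹' {t} ⊆ U) :
        ∃ (V : Opens Y) (h : V ≤ U), K ∩ f m ⁻¹' {t} ⊆ V ∧ T.Null (T.res h u) := by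
      refine ih hi u (hK.inter_right (isClosed_singleton.preimage (hf m))) hU ?_
      rintro x ⟨hx, hxt⟩ y ⟨hy, hyt⟩ h
      refine hsep x hx y hy fun i hi => ?_
      rcases Nat.lt_succ_iff_lt_or_eq.1 hi with hi | rfl
      · exact h i hi
      · exact hxt.trans hyt.symm
    push_cast at hj
    choose V hVW hKV hVs using fun t : ℝ => hslice t (i := j + 1) (by omega) W s
      (Set.inter_subset_left.trans hKW)
    obtain ⟨A, B, hAB, hKAB⟩ : ∃ A B : ℝ, A ≤ B ∧ ∀ x ∈ K, f m x ∈ Set.Icc A B := by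
      obtain ⟨C, hC⟩ := (hK.image (hf m)).isBounded.exists_norm_le
      refine ⟨-|C|, |C|, neg_le_self (abs_nonneg C), fun x hx => abs_le.1 ?_⟩
      exact (hC _ ⟨x, hx, rfl⟩).trans (le_abs_self C)
    -- `c t` consists of the levels whose slice of `K` lies in `V t`. It is open because `K \ V t`
    -- has compact image; a fine subdivision of `[A, B]` therefore cuts `K` into strips on each of
    -- which `s` vanishes.
    let c (t : Set.Icc A B) : Set (Set.Icc A B) :=
      {r | (r : ℝ) ∉ f m '' (K \ V t)}
    have hc (t : Set.Icc A B) : IsOpen (c t) :=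
      ((hK.diff (V t).isOpen).image (hf m)).isClosed.isOpen_compl.preimage continuous_subtype_val
    obtain ⟨r, hr₀, hr, ⟨M, hM⟩, hrc⟩ := exists_monotone_Icc_subset_open_cover_Icc hAB hc
      fun t _ => Set.mem_iUnion.2 ⟨t, fun ⟨x, hx, hxt⟩ => hx.2 (hKV t ⟨hx.1, hxt⟩)⟩
    -- The strips are added one at a time. Each overlap is a single slice, and the obstruction
    -- there, of degree `j`, is killed by `hslice`.
    have hn (n : ℕ) : ∃ (U : Opens Y) (h : U ≤ W),
        K ∩ f m ⁻¹' Set.Icc A (r n) ⊆ U ∧ T.Null (T.res h s) := by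
      induction n with
      | zero =>
        refine ⟨V A, hVW A, fun x hx => hKV A ⟨hx.1, ?_⟩, hVs A⟩
        have h := hx.2
        rw [hr₀] at h
        exact le_antisymm h.2 h.1
      | succ n ihn =>
        obtain ⟨t, ht⟩ := hrc n
        have h₂ : ∃ (U : Opens Y) (h : U ≤ W),
            K ∩ f m ⁻¹' Set.Icc (r n : ℝ) (r (n + 1)) ⊆ U ∧ T.Null (T.res h s) := by
          refine ⟨V t, hVW t, fun x hx => ?_, hVs t⟩
          by_contra hxV
          exact ht (a := ⟨f m x, hKAB x hx.1⟩) hx.2 ⟨x, ⟨hx.1, hxV⟩, rfl⟩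
        have hA := (r n).2.1
        have hrn : (r n : ℝ) ≤ r (n + 1) := hr n.le_succ
        obtain ⟨U, hU, hKU, hUs⟩ := T.exists_null_union s (hf m) (r n : ℝ)
          (fun x hx => hx.2.2) (fun x hx => hx.2.1) ihn h₂
          (L := K ∩ f m ⁻¹' {(r n : ℝ)}) (fun x hx h => ⟨hx.1, h⟩) (fun x hx h => ⟨hx.1, h⟩)
          (fun x hx => ⟨hx.1, by rw [Set.mem_preimage, hx.2]; exact ⟨hA, le_rfl⟩⟩)
          (fun x hx => ⟨hx.1, by rw [Set.mem_preimage, hx.2]; exact ⟨le_rfl, hrn⟩⟩)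
          (fun U u hU => hslice _ (by omega) U u hU)
        refine ⟨U, hU, fun x hx => hKU ?_, hUs⟩
        rcases le_total (f m x) (r n) with h | h
        · exact Or.inl ⟨hx.1, hx.2.1, h⟩
        · exact Or.inr ⟨hx.1, h, hx.2.2⟩
    obtain ⟨U, hU, hKU, hUs⟩ := hn M
    refine ⟨U, hU, fun x hx => hKU ⟨hx, ?_⟩, hUs⟩
    rw [hM M le_rfl]
    exact hKAB x hx

end MayerVietorisTheory

/-- A neighbourhood of a point of a space `X` on which the classes of every Mayer-Vietoris theory
vanish in degrees larger than `b + d`. -/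
def HasLocalDimLE (X : Type) [TopologicalSpace X] (d : ℕ) : Prop :=
  ∀ (U : Opens X), ∀ x ∈ U, ∃ (Y : Type) (_ : TopologicalSpace Y) (p : Y → X)
    (_ : Topology.IsOpenEmbedding p) (y : Y) (V : Opens Y), p y = x ∧ (∀ y, p y ∈ U) ∧ y ∈ V ∧
    ∀ (b : ℤ) (T : MayerVietorisTheory Y b) (j : ℤ) (s : T.Cls j ⊤), b + d < j →
      T.Null (T.res le_top s : T.Cls j V)

/-! ### Restriction in the total category, linearity and associated modules. -/

namespace Algebroid

variable {R : Type} [CommRing R] {X : TopCat.{0}} (A : Algebroid R X)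

lemma homMk_toRestrict_comp {c e : A.Total} {V : Opens X} (i : V ⟶ c.base.unop)
    (j : op V ⟶ e.base)
    (a : (A.F.map j.toLoc).toFunctor.obj (A.restrict c i).fiber ⟶ e.fiber) :
    A.toRestrict c i ≫ A.homMk (c := A.restrict c i) j a = A.homMk (i.op ≫ j)
      ((A.F.mapComp i.op.toLoc j.toLoc).hom.toNatTrans.app c.fiber ≫ a) := by
  refine Pseudofunctor.Grothendieck.Hom.ext _ _ rfl ?_
  change 𝟙 _ ≫ (A.F.mapComp i.op.toLoc j.toLoc).hom.toNatTrans.app c.fiber ≫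
    (A.F.map j.toLoc).toFunctor.map (𝟙 ((A.F.map i.op.toLoc).toFunctor.obj c.fiber)) ≫ a = _
  erw [CategoryTheory.Functor.map_id, Category.id_comp, Category.id_comp]
  rfl

lemma mapComp_inv_hom_comp {c e : A.Total} {V : Opens X} (i : V ⟶ c.base.unop)
    (j : op V ⟶ e.base)
    (a : (A.F.map j.toLoc).toFunctor.obj (A.restrict c i).fiber ⟶ e.fiber) :
    (A.F.mapComp i.op.toLoc j.toLoc).inv.toNatTrans.app c.fiber ≫
      (A.F.mapComp i.op.toLoc j.toLoc).hom.toNatTrans.app c.fiber ≫ a = a := by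
  have h : (A.F.mapComp i.op.toLoc j.toLoc).inv.toNatTrans.app c.fiber ≫
      (A.F.mapComp i.op.toLoc j.toLoc).hom.toNatTrans.app c.fiber = 𝟙 _ := by
    rw [← Cat.Hom₂.comp_app, Iso.inv_hom_id]; rfl
  exact (Category.assoc _ _ _).symm.trans ((congrArg (· ≫ a) h).trans (Category.id_comp a))

lemma homMk_injective {c d : A.Total} (i : c.base ⟶ d.base) :
    Function.Injective (A.homMk (c := c) (d := d) i) := by
  intro a b h
  injection h

/-- Up to the isomorphism `mapComp`, composing with a restriction does not change the fibre
component. Hence factorizations from `exists_fac` are unique, and identities between morphisms out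
of a restriction can be checked on `c`. -/
instance epi_toRestrict {c : A.Total} {V : Opens X} (i : V ⟶ c.base.unop) :
    Epi (A.toRestrict c i) where
  left_cancellation {e} g h H := by
    obtain ⟨j, a⟩ := g
    obtain ⟨j', b⟩ := h
    obtain rfl : j = j' := Subsingleton.elim _ _
    have H' := A.homMk_injective _ ((A.homMk_toRestrict_comp i j a).symm.trans
      (H.trans (A.homMk_toRestrict_comp i j b)))
    have H'' := congrArg ((A.F.mapComp i.op.toLoc j.toLoc).inv.toNatTrans.app c.fiber ≫ ·) H'
    rw [(A.mapComp_inv_hom_comp i j a).symm.trans (H''.trans (A.mapComp_inv_hom_comp i j b))]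

lemma ι_injective {c d : A.Total} (i : c.base ⟶ d.base) : Function.Injective (A.ι (d := d) i) := by
  classical
  exact DirectSum.of_injective (β := fun i : c.base ⟶ d.base =>
    ((A.F.map i.toLoc).toFunctor.obj c.fiber ⟶ d.fiber)) i

/-- Inclusions of open sets form a subsingleton, so the direct sum has a single summand as soon as
an index exists. -/
lemma ι_surjective {c d : A.Total} (i : c.base ⟶ d.base) :
    Function.Surjective (A.ι (d := d) i) := by
  have h : (LinearMap.range (A.ι (d := d) i)).mkQ = 0 := A.homModule_ext fun f => by
    obtain ⟨i', a⟩ := f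
    obtain rfl : i' = i := Subsingleton.elim _ _
    exact (Submodule.Quotient.mk_eq_zero _).2 ⟨a, rfl⟩
  intro x
  exact (Submodule.Quotient.mk_eq_zero _).1 (LinearMap.congr_fun h x)

/-- This embeds the extension by zero from `V` into the one from `U`: over subsets of `V` the map is
composition with an isomorphism, and elsewhere its source is zero. -/
lemma precomp_toRestrict_injective {c : A.Total} {V : Opens X} (i : V ⟶ c.base.unop) (e : A.Total) :
    Function.Injective (A.precomp (A.toRestrict c i) e) := by
  by_cases hj : Nonempty ((A.restrict c i).base ⟶ e.base)
  · obtain ⟨j⟩ := hj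
    intro x y h
    obtain ⟨a, rfl⟩ := A.ι_surjective j x
    obtain ⟨b, rfl⟩ := A.ι_surjective j y
    have ha (a) : A.precomp (A.toRestrict c i) e (A.ι j a) = A.ι (i.op ≫ j) _ :=
      (A.precomp_single (A.toRestrict c i) (A.homMk j a)).trans
        (congrArg A.single (A.homMk_toRestrict_comp i j a))
    rw [ha a, ha b] at h
    have h' := congrArg ((A.F.mapComp i.op.toLoc j.toLoc).inv.toNatTrans.app c.fiber ≫ ·)
      (A.ι_injective _ h)
    exact congrArg _ ((A.mapComp_inv_hom_comp i j a).symm.trans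
      (h'.trans (A.mapComp_inv_hom_comp i j b)))
  · have h0 : (LinearMap.id : A.homModule (A.restrict c i) e →ₗ[R] _) = 0 :=
      A.homModule_ext fun f => (hj ⟨f.base⟩).elim
    intro x y _
    exact (LinearMap.congr_fun h0 x).trans (LinearMap.congr_fun h0 y).symm

lemma exists_linear_postcomp {c d e : A.Total} (f : c ⟶ d) (i : d.base ⟶ e.base) :
    ∃ K : ((A.F.map i.toLoc).toFunctor.obj d.fiber ⟶ e.fiber) →ₗ[R]
        ((A.F.map (f.base ≫ i).toLoc).toFunctor.obj c.fiber ⟶ e.fiber),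
      ∀ a, f ≫ A.homMk i a = A.homMk (f.base ≫ i) (K a) :=
  ⟨Linear.leftComp R _ ((A.F.mapComp f.base.toLoc i.toLoc).hom.toNatTrans.app c.fiber ≫
      (A.F.map i.toLoc).toFunctor.map f.fiber), fun _ =>
    congrArg (A.homMk (f.base ≫ i)) (Category.assoc _ _ _).symm⟩

lemma postcomp_homMk_add (c : A.Total) {d e : A.Total} (i : d.base ⟶ e.base)
    (a b : (A.F.map i.toLoc).toFunctor.obj d.fiber ⟶ e.fiber) :
    A.postcomp c (A.homMk i (a + b)) = A.postcomp c (A.homMk i a) + A.postcomp c (A.homMk i b) := by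
  refine A.homModule_ext fun f => ?_
  obtain ⟨K, hK⟩ := A.exists_linear_postcomp f i
  rw [LinearMap.add_apply, postcomp_single, postcomp_single, postcomp_single, hK, hK, hK, map_add]
  exact map_add (A.ι _) _ _

lemma postcomp_homMk_smul (c : A.Total) {d e : A.Total} (i : d.base ⟶ e.base) (r : R)
    (a : (A.F.map i.toLoc).toFunctor.obj d.fiber ⟶ e.fiber) :
    A.postcomp c (A.homMk i (r • a)) = r • A.postcomp c (A.homMk i a) := by
  refine A.homModule_ext fun f => ?_
  obtain ⟨K, hK⟩ := A.exists_linear_postcomp f i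
  rw [LinearMap.smul_apply, postcomp_single, postcomp_single, hK, hK, map_smul]
  exact map_smul (A.ι _) _ _

lemma isLinear_tensorBimodule (L : ModuleCat.{0} R) (c : A.Site) :
    A.IsLinear ((A.tensorBimodule L).obj c) where
  map_add {d e} i a b := by
    refine A.tensorBimodule_ext L fun l f => ?_
    change TensorProduct.tmul R l (A.postcomp c.unop (A.homMk i (a + b)) (A.single f)) =
      TensorProduct.tmul R l (A.postcomp c.unop (A.homMk i a) (A.single f)) +
      TensorProduct.tmul R l (A.postcomp c.unop (A.homMk i b) (A.single f))
    rw [postcomp_homMk_add, LinearMap.add_apply, TensorProduct.tmul_add]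
  map_smul {d e} i r a := by
    refine A.tensorBimodule_ext L fun l f => ?_
    change TensorProduct.tmul R l (A.postcomp c.unop (A.homMk i (r • a)) (A.single f)) =
      r • TensorProduct.tmul R l (A.postcomp c.unop (A.homMk i a) (A.single f))
    rw [postcomp_homMk_smul, LinearMap.smul_apply, TensorProduct.tmul_smul]

variable {A} in
/-- A sheaf which is locally a quotient of a linear presheaf is linear. -/
lemma IsLinear.of_isLocallySurjective {M : A.Siteᵒᵖ ⥤ ModuleCat.{0} R}
    {N : Sheaf A.topology (ModuleCat.{0} R)} (f : M ⟶ N.obj)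
    [Presheaf.IsLocallySurjective A.topology f] (hM : A.IsLinear M) : A.IsLinear N.obj := by
  -- Near `x` the section `q` lifts to a section `m` of the presheaf, and `a` then acts through a
  -- linear map `K`; this reduces linearity of `N` to that of `M`.
  have key {c d : A.Total} (i : c.base ⟶ d.base) (q : N.obj.obj (op (op c))) (x : X)
      (hx : x ∈ d.base.unop) : ∃ (W : Opens X) (j : W ⟶ d.base.unop) (e : A.Total)
        (b : e.base ⟶ (A.restrict d j).base)
        (K : ((A.F.map i.toLoc).toFunctor.obj c.fiber ⟶ d.fiber) →ₗ[R]
          ((A.F.map b.toLoc).toFunctor.obj e.fiber ⟶ (A.restrict d j).fiber))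
        (m : M.obj (op (op e))), x ∈ W ∧
        ∀ a, N.obj.map (A.toRestrict d j).op.op (N.obj.map (A.homMk i a).op.op q) =
          f.app _ (M.map (A.homMk b (K a)).op.op m) := by
    obtain ⟨V, v, hxV, m, hm⟩ := Presheaf.imageSieve_mem A.topology f q x (leOfHom i.unop hx)
    let j : V ⊓ d.base.unop ⟶ d.base.unop := homOfLE inf_le_right
    obtain ⟨K₁, hK₁⟩ := A.exists_linear_comp i (A.toRestrict d j)
    obtain ⟨K₂, hK₂⟩ := A.exists_linear_fac (e := A.restrict d j) v (homOfLE inf_le_left)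
      (i ≫ (A.toRestrict d j).base)
    refine ⟨_, j, A.restrict c v, _, K₂ ∘ₗ K₁, m, ⟨hxV, hx⟩, fun a => ?_⟩
    have e₁ : A.homMk i a ≫ A.toRestrict d j = A.toRestrict c v ≫ _ :=
      (hK₁ a).trans (hK₂ _).symm
    calc N.obj.map (A.toRestrict d j).op.op (N.obj.map (A.homMk i a).op.op q)
        = N.obj.map (A.homMk i a ≫ A.toRestrict d j).op.op q := by
          rw [op_comp, op_comp, Functor.map_comp]; rfl
      _ = _ := by rw [e₁, op_comp, op_comp, Functor.map_comp]; rfl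
      _ = N.obj.map _ (f.app _ m) := congrArg _ hm.symm
      _ = _ := (NatTrans.naturality_apply f _ m).symm
  constructor
  · intro c d i a b
    ext q
    refine A.eq_of_locally_eq N _ _ fun x hx => ?_
    obtain ⟨W, j, e, b', K, m, hxW, hK⟩ := key i q x hx
    refine ⟨W, j, hxW, ?_⟩
    simp [hK, hM.map_add]
  · intro c d i r a
    ext q
    refine A.eq_of_locally_eq N _ _ fun x hx => ?_
    obtain ⟨W, j, e, b', K, m, hxW, hK⟩ := key i q x hx
    refine ⟨W, j, hxW, ?_⟩
    simp [hK, hM.map_smul]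

/-- The module associated with a linear presheaf. -/
def sheafify (P : A.Siteᵒᵖ ⥤ ModuleCat.{0} R) (hP : A.IsLinear P) : A.Mod :=
  ⟨(presheafToSheaf A.topology _).obj P, by
    have : Presheaf.IsLocallySurjective A.topology (toSheafify A.topology P) := inferInstance
    exact IsLinear.of_isLocallySurjective
      (N := (presheafToSheaf A.topology _).obj P) (toSheafify A.topology P) hP⟩

end Algebroid

/-- The last two hypotheses say that `S.g` is a cokernel of `S.f`. This suits associated modules,
since the maps out of them are known explicitly while their sections are not. -/
lemma shortExact_of_hom {C : Type*} [Category* C] [Abelian C] (S : ShortComplex C) (hf : Mono S.f)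
    (h₁ : ∀ (N : C) (a b : S.X₃ ⟶ N), S.g ≫ a = S.g ≫ b → a = b)
    (h₂ : ∀ (N : C) (a : S.X₂ ⟶ N), S.f ≫ a = 0 → ∃ b, S.g ≫ b = a) : S.ShortExact := by
  have : Epi S.g := ⟨fun a b => h₁ _ a b⟩
  choose b hb using h₂
  have hS : IsColimit (CokernelCofork.ofπ S.g S.zero) :=
    CokernelCofork.IsColimit.ofπ _ _ (fun a ha => b _ a ha) (fun a ha => hb _ a ha)
      fun a ha m hm => h₁ _ _ _ (hm.trans (hb _ a ha).symm)
  exact { exact := ShortComplex.exact_of_g_is_cokernel _ hS }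

/-- A class with values in a K-injective complex vanishes if it vanishes on the two corners of a
suitable square, in a compatible way. -/
lemma exists_comp_d_eq_of_square {C : Type*} [Category* C] [Abelian C] {I : CochainComplex C ℤ}
    (hI : I.IsKInjective) {X₁ Y₁ Y₂ X₃ : C} (q₁ : X₁ ⟶ Y₁) (q₂ : X₁ ⟶ Y₂) (p₁ : Y₁ ⟶ X₃)
    (p₂ : Y₂ ⟶ X₃) [Mono q₁] (w : q₁ ≫ p₁ = q₂ ≫ p₂)
    (h₁ : ∀ (N : C) (a b : X₃ ⟶ N), p₁ ≫ a = p₁ ≫ b → p₂ ≫ a = p₂ ≫ b → a = b)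
    (h₂ : ∀ (N : C) (a₁ : Y₁ ⟶ N) (a₂ : Y₂ ⟶ N), q₁ ≫ a₁ = q₂ ≫ a₂ →
      ∃ b, p₁ ≫ b = a₁ ∧ p₂ ≫ b = a₂)
    {h i j k : ℤ} (hi : h + 1 = i) (hj : i + 1 = j) (hk : j + 1 = k)
    (φ : X₃ ⟶ I.X j) (ψ₁ : Y₁ ⟶ I.X i) (ψ₂ : Y₂ ⟶ I.X i) (χ : X₁ ⟶ I.X h)
    (hφ : φ ≫ I.d j k = 0) (hψ₁ : p₁ ≫ φ = ψ₁ ≫ I.d i j) (hψ₂ : p₂ ≫ φ = ψ₂ ≫ I.d i j)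
    (hχ : q₁ ≫ ψ₁ - q₂ ≫ ψ₂ = χ ≫ I.d h i) : ∃ θ : X₃ ⟶ I.X i, θ ≫ I.d i j = φ := by
  -- The sign in `(q₁, -q₂)` makes the composite zero and turns the compatibility on `X₁` into the
  -- difference in `hχ`.
  let S : ShortComplex C := ShortComplex.mk (biprod.lift q₁ (-q₂)) (biprod.desc p₁ p₂)
    (by rw [biprod.lift_desc, w, Preadditive.neg_comp, add_neg_cancel])
  have hS : S.ShortExact := by
    refine shortExact_of_hom _ (mono_of_mono_fac (biprod.lift_fst q₁ (-q₂))) (fun N a b hab => ?_)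
      (fun N a ha => ?_)
    · refine h₁ N a b ?_ ?_
      · simpa [S] using congrArg (fun t : Y₁ ⊞ Y₂ ⟶ N => biprod.inl ≫ t) hab
      · simpa [S] using congrArg (fun t : Y₁ ⊞ Y₂ ⟶ N => biprod.inr ≫ t) hab
    · obtain ⟨b, hb₁, hb₂⟩ := h₂ N (biprod.inl ≫ a) (biprod.inr ≫ a) (by
        rw [← sub_eq_zero, ← ha]
        simp only [S, biprod.lift_eq, Preadditive.add_comp, Preadditive.neg_comp, Category.assoc,
          sub_eq_add_neg])
      refine ⟨b, biprod.hom_ext' _ _ ?_ ?_⟩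
      · simpa [S] using hb₁
      · simpa [S] using hb₂
  refine exists_comp_d_eq hI hS hi hj hk φ (biprod.desc ψ₁ ψ₂) χ hφ ?_ ?_
  · refine biprod.hom_ext' _ _ ?_ ?_
    · simpa [S] using hψ₁
    · simpa [S] using hψ₂
  · rw [← hχ]
    simp [S, sub_eq_add_neg]

/-! ### Sections as morphisms from free modules. -/

namespace Algebroid

variable {R : Type} [CommRing R] {X : TopCat.{0}} (A : Algebroid R X)

/-- The sections `(U, σ) ↦ Γ(U; N(σ))`, as a functor in `(U, σ)` and `N`. -/
def ev : A.Total ⥤ A.Mod ⥤ ModuleCat.{0} R where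
  obj c := A.isModule.ι ⋙ sheafToPresheaf _ _ ⋙ (evaluation _ _).obj (op (op c))
  map g := Functor.whiskerLeft _ (Functor.whiskerLeft _ ((evaluation _ _).map g.op.op))

instance (c : A.Total) : (A.ev.obj c).Additive where
  map_add := rfl

lemma ev_map_comp_apply {c d e : A.Total} (f : c ⟶ d) (g : d ⟶ e) {N : A.Mod}
    (n : (A.ev.obj c).obj N) :
    (A.ev.map (f ≫ g)).app N n = (A.ev.map g).app N ((A.ev.map f).app N n) := by
  rw [A.ev.map_comp]; rfl

lemma ev_map_id_apply {c : A.Total} {N : A.Mod} (n : (A.ev.obj c).obj N) :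
    (A.ev.map (𝟙 c)).app N n = n := by
  rw [A.ev.map_id]; rfl

lemma ev_naturality_apply {c d : A.Total} (g : c ⟶ d) {M N : A.Mod} (f : M ⟶ N)
    (m : (A.ev.obj c).obj M) :
    (A.ev.map g).app N ((A.ev.obj c).map f m) = (A.ev.obj d).map f ((A.ev.map g).app M m) :=
  NatTrans.naturality_apply (A.ev.map g) f m

section Sheafify

variable {A} {P Q : A.Siteᵒᵖ ⥤ ModuleCat.{0} R} (hP : A.IsLinear P) (hQ : A.IsLinear Q) {M N : A.Mod}

/-- The morphism from the associated module which extends a morphism from a linear presheaf. -/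
def sheafifyDesc (f : P ⟶ N.obj.obj) : A.sheafify P hP ⟶ N :=
  ObjectProperty.homMk (ObjectProperty.homMk (CategoryTheory.sheafifyLift A.topology f N.obj.property))

variable {hP} in
/-- The restriction of a morphism from the associated module to the presheaf. -/
def ofSheafify (f : A.sheafify P hP ⟶ N) : P ⟶ N.obj.obj :=
  toSheafify A.topology P ≫ f.hom.hom

@[simp]
lemma ofSheafify_sheafifyDesc (f : P ⟶ N.obj.obj) : ofSheafify (sheafifyDesc hP f) = f :=
  toSheafify_sheafifyLift _ _ _

variable {hP hQ} in
lemma sheafify_hom_ext {f g : A.sheafify P hP ⟶ N} (h : ofSheafify f = ofSheafify g) : f = g :=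
  A.isModule.hom_ext (ObjectProperty.hom_ext _ (CategoryTheory.sheafify_hom_ext _ _ _ N.obj.property h))

variable {hP} in
lemma ofSheafify_comp (f : A.sheafify P hP ⟶ M) (g : M ⟶ N) :
    ofSheafify (f ≫ g) = ofSheafify f ≫ g.hom.hom :=
  (Category.assoc _ _ _).symm

/-- The functoriality of the associated module. -/
def sheafifyMap (τ : P ⟶ Q) : A.sheafify P hP ⟶ A.sheafify Q hQ :=
  sheafifyDesc hP (τ ≫ toSheafify A.topology Q)

lemma ofSheafify_sheafifyMap_comp (τ : P ⟶ Q) (f : A.sheafify Q hQ ⟶ N) :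
    ofSheafify (sheafifyMap hP hQ τ ≫ f) = τ ≫ ofSheafify f := by
  rw [ofSheafify_comp, sheafifyMap, ofSheafify_sheafifyDesc]
  exact Category.assoc _ _ _

/-- Sheafification is left exact, and the inclusion of modules into sheaves reflects monomorphisms.
-/
lemma mono_sheafifyMap (τ : P ⟶ Q) [Mono τ] : Mono (sheafifyMap hP hQ τ) := by
  have h : A.isModule.ι.map (sheafifyMap hP hQ τ) = (presheafToSheaf A.topology _).map τ :=
    ObjectProperty.hom_ext _ (CategoryTheory.sheafify_hom_ext _ _ _ ((presheafToSheaf A.topology _).obj Q).property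
      ((toSheafify_sheafifyLift _ _ _).trans (toSheafify_naturality _ τ)))
  have : PreservesFiniteLimits (presheafToSheaf A.topology (ModuleCat.{0} R)) := inferInstance
  have hmono : (presheafToSheaf A.topology (ModuleCat.{0} R)).PreservesMonomorphisms := inferInstance
  have : Mono ((presheafToSheaf A.topology _).map τ) := hmono.preserves τ
  have : Mono (A.isModule.ι.map (sheafifyMap hP hQ τ)) := by rw [h]; exact this
  exact A.isModule.ι.mono_of_mono_map this

end Sheafify

section Free

variable (L : ModuleCat.{0} R) (c : A.Total) {N : A.Mod}

/-- The module `L ⊗ 𝒜(σ, ·)`, extended by zero from `U`, for `c = (U, σ)`. -/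
abbrev free : A.Mod := A.sheafify _ (A.isLinear_tensorBimodule L (op c))

variable {c} in
/-- The morphism `L ⟶ Γ(U; N(σ))` defined by a morphism from `A.free L c`. -/
def ofFree (f : A.free L c ⟶ N) : L ⟶ (A.ev.obj c).obj N :=
  A.unitMap L (op (op c)) ≫ (ofSheafify f).app (op (op c))

/-- The universal property of sheafification combined with a Yoneda lemma, `isIso_evalAtUnit`. For
`L = R` it says that `A.free` represents the sections over `c`. -/
lemma ofFree_bijective : Function.Bijective (A.ofFree L (c := c) (N := N)) := by
  have h₁ : Function.Bijective (ofSheafify (N := N)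
      (hP := A.isLinear_tensorBimodule L (op c))) :=
    ⟨fun _ _ => sheafify_hom_ext, fun f => ⟨_, ofSheafify_sheafifyDesc _ f⟩⟩
  have := isIso_evalAtUnit L N.property
  have h₂ : Function.Bijective ((A.evalAtUnit L N.obj.obj).app (op (op c))) :=
    (ConcreteCategory.isIso_iff_bijective _).1 inferInstance
  exact h₂.comp h₁

/-- The morphism from `A.free L c` defined by a morphism `L ⟶ Γ(U; N(σ))`. -/
def freeDesc (n : L ⟶ (A.ev.obj c).obj N) : A.free L c ⟶ N :=
  ((A.ofFree_bijective L c).2 n).choose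

@[simp]
lemma ofFree_freeDesc (n : L ⟶ (A.ev.obj c).obj N) : A.ofFree L (A.freeDesc L c n) = n :=
  ((A.ofFree_bijective L c).2 n).choose_spec

variable {L c} in
lemma free_hom_ext {f g : A.free L c ⟶ N} (h : A.ofFree L f = A.ofFree L g) : f = g :=
  (A.ofFree_bijective L c).1 h

lemma ofFree_comp {M : A.Mod} (f : A.free L c ⟶ M) (g : M ⟶ N) :
    A.ofFree L (f ≫ g) = A.ofFree L f ≫ (A.ev.obj c).map g := by
  rw [ofFree, ofSheafify_comp]
  exact (Category.assoc _ _ _).symm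

lemma ofFree_zero : A.ofFree L (0 : A.free L c ⟶ N) = 0 := by
  rw [← zero_comp (f := (0 : N ⟶ N)), ofFree_comp, Functor.map_zero, comp_zero]

/-- The morphism given by restriction. -/
def freeRes {c d : A.Total} (g : c ⟶ d) : A.free L d ⟶ A.free L c :=
  sheafifyMap _ _ ((A.tensorBimodule L).map g.op)

lemma ofFree_freeRes_comp {c d : A.Total} (g : c ⟶ d) (f : A.free L c ⟶ N) :
    A.ofFree L (A.freeRes L g ≫ f) = A.ofFree L f ≫ (A.ev.map g).app N := by
  have h := ((A.evalAtUnit L N.obj.obj).naturality g.op.op)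
  have h' := congrArg (fun t => t (ofSheafify f)) h
  rw [ofFree, freeRes, ofSheafify_sheafifyMap_comp]
  exact h'

/-- The functoriality of `L ⊗ 𝒜(σ, ·)` in `L`. -/
def tensorBimoduleMap {L' L : ModuleCat.{0} R} (k : L' ⟶ L) (c : A.Site) :
    (A.tensorBimodule L').obj c ⟶ (A.tensorBimodule L).obj c :=
  Functor.whiskerLeft (A.bimodule.obj c) ((MonoidalCategory.curriedTensor _).map k)

/-- The functoriality of `A.free L c` in `L`. -/
def freeMap {L' L : ModuleCat.{0} R} (k : L' ⟶ L) (c : A.Total) : A.free L' c ⟶ A.free L c :=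
  sheafifyMap _ _ (A.tensorBimoduleMap k (op c))

lemma ofFree_freeMap_comp {L' L : ModuleCat.{0} R} (k : L' ⟶ L) (c : A.Total)
    (f : A.free L c ⟶ N) : A.ofFree L' (A.freeMap k c ≫ f) = k ≫ A.ofFree L f := by
  rw [ofFree, freeMap, ofSheafify_sheafifyMap_comp]
  rfl

end Free

section Sections

variable {A} {c d : A.Total} {M N : A.Mod}

lemma ofFree_add (L : ModuleCat.{0} R) (f g : A.free L c ⟶ N) :
    A.ofFree L (f + g) = A.ofFree L f + A.ofFree L g := by
  have h : ofSheafify (f + g) = ofSheafify f + ofSheafify g := Preadditive.comp_add _ _ _ _ _ _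
  rw [ofFree, h]
  exact Preadditive.comp_add _ _ _ _ _ _

/-- The morphism defined by a section. -/
def secHom (n : (A.ev.obj c).obj N) : A.free (ModuleCat.of R R) c ⟶ N :=
  A.freeDesc _ c (ModuleCat.ofHom (LinearMap.toSpanSingleton R ((A.ev.obj c).obj N) n))

lemma ofFree_secHom_one (n : (A.ev.obj c).obj N) :
    A.ofFree _ (secHom n) (1 : R) = n :=
  (congrArg (fun t : ModuleCat.of R R ⟶ (A.ev.obj c).obj N => t (1 : R)) (A.ofFree_freeDesc _ c _)).trans (one_smul R n)

lemma freeOne_hom_ext {f g : A.free (ModuleCat.of R R) c ⟶ N}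
    (h : A.ofFree _ f (1 : R) = A.ofFree _ g (1 : R)) : f = g := by
  refine A.free_hom_ext ?_
  ext1
  exact LinearMap.ext_ring h

lemma secHom_surjective (f : A.free (ModuleCat.of R R) c ⟶ N) :
    ∃ n : (A.ev.obj c).obj N, f = secHom n :=
  ⟨A.ofFree _ f (1 : R), freeOne_hom_ext (ofFree_secHom_one _).symm⟩

lemma secHom_injective {m n : (A.ev.obj c).obj N} (h : secHom m = secHom n) : m = n := by
  rw [← ofFree_secHom_one m, h, ofFree_secHom_one]

lemma secHom_comp (m : (A.ev.obj c).obj M) (f : M ⟶ N) :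
    secHom m ≫ f = secHom ((A.ev.obj c).map f m) := by
  refine freeOne_hom_ext ?_
  rw [ofFree_comp, ofFree_secHom_one, ModuleCat.comp_apply, ofFree_secHom_one]

lemma freeRes_secHom (g : c ⟶ d) (n : (A.ev.obj c).obj N) :
    A.freeRes _ g ≫ secHom n = secHom ((A.ev.map g).app N n) := by
  refine freeOne_hom_ext ?_
  rw [ofFree_freeRes_comp, ofFree_secHom_one, ModuleCat.comp_apply, ofFree_secHom_one]

lemma secHom_add (m n : (A.ev.obj c).obj N) : secHom (m + n) = secHom m + secHom n := by
  refine freeOne_hom_ext ?_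
  rw [ofFree_add, ofFree_secHom_one]
  exact (congrArg₂ (· + ·) (ofFree_secHom_one m) (ofFree_secHom_one n)).symm

lemma secHom_zero : secHom (0 : (A.ev.obj c).obj N) = 0 := by
  have h := secHom_add (0 : (A.ev.obj c).obj N) 0
  rwa [add_zero, left_eq_add] at h

lemma secHom_sub (m n : (A.ev.obj c).obj N) : secHom (m - n) = secHom m - secHom n := by
  rw [eq_sub_iff_add_eq, ← secHom_add, sub_add_cancel]

lemma ev_map_injective (f : M ⟶ N) [Mono f] : Function.Injective ((A.ev.obj c).map f) := by
  intro m n h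
  refine secHom_injective ((cancel_mono f).1 ?_)
  rw [secHom_comp, secHom_comp, h]

variable (A) in
lemma ev_eq_of_locally_eq (m n : (A.ev.obj c).obj N)
    (h : ∀ x ∈ c.base.unop, ∃ (V : Opens X) (i : V ⟶ c.base.unop), x ∈ V ∧
      (A.ev.map (A.toRestrict c i)).app N m = (A.ev.map (A.toRestrict c i)).app N n) : m = n :=
  A.eq_of_locally_eq N.obj m n h

/-- A morphism of modules is an epimorphism if it is locally surjective on sections. -/
lemma epi_of_locally_surjective (f : M ⟶ N)
    (h : ∀ (c : A.Total) (n : (A.ev.obj c).obj N), ∀ x ∈ c.base.unop,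
      ∃ (V : Opens X) (i : V ⟶ c.base.unop) (m : (A.ev.obj (A.restrict c i)).obj M), x ∈ V ∧
        (A.ev.obj _).map f m = (A.ev.map (A.toRestrict c i)).app N n) : Epi f where
  left_cancellation {Z} a b hab := by
    refine A.isModule.hom_ext (ObjectProperty.hom_ext _ (NatTrans.ext (funext fun c => ?_)))
    ext n
    change (A.ev.obj c.unop.unop).obj N at n
    refine A.ev_eq_of_locally_eq (c := c.unop.unop) (N := Z) ((A.ev.obj c.unop.unop).map a n)
      ((A.ev.obj c.unop.unop).map b n) fun x hx => ?_
    obtain ⟨V, i, m, hxV, hm⟩ := h c.unop.unop n x hx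
    refine ⟨V, i, hxV, ?_⟩
    rw [ev_naturality_apply, ev_naturality_apply, ← hm]
    exact congrArg (fun t => (A.ev.obj _).map t m) hab

/-- An epimorphism of modules is locally surjective on sections. -/
lemma exists_local_lift (f : M ⟶ N) [Epi f] (n : (A.ev.obj c).obj N) (x : X)
    (hx : x ∈ c.base.unop) :
    ∃ (V : Opens X) (i : V ⟶ c.base.unop) (m : (A.ev.obj (A.restrict c i)).obj M), x ∈ V ∧
      (A.ev.obj _).map f m = (A.ev.map (A.toRestrict c i)).app N n := by
  have := A.isModule.preservesEpimorphisms_ι_of_isNormalMonoCategory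
  have : Epi f.hom := inferInstanceAs (Epi (A.isModule.ι.map f))
  have := (Sheaf.isLocallySurjective_iff_epi' (J := A.topology) (A := ModuleCat.{0} R) f.hom).2
      inferInstance
  obtain ⟨V, v, hxV, m, hm⟩ := Presheaf.imageSieve_mem A.topology f.hom.hom n x hx
  exact ⟨V, v, m, hxV, hm⟩

/-- Exactness in `Mod(𝒜)` can be checked locally on sections. -/
lemma exact_iff_locally (S : ShortComplex A.Mod) : S.Exact ↔
    ∀ (c : A.Total) (s : (A.ev.obj c).obj S.X₂), (A.ev.obj c).map S.g s = 0 →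
      ∀ x ∈ c.base.unop, ∃ (V : Opens X) (i : V ⟶ c.base.unop)
        (t : (A.ev.obj (A.restrict c i)).obj S.X₁), x ∈ V ∧
        (A.ev.obj _).map S.f t = (A.ev.map (A.toRestrict c i)).app S.X₂ s := by
  rw [S.exact_iff_epi_kernel_lift]
  have hl {e : A.Total} (t : (A.ev.obj e).obj S.X₁) : (A.ev.obj e).map (kernel.ι S.g)
      ((A.ev.obj e).map (kernel.lift S.g S.f S.zero) t) = (A.ev.obj e).map S.f t := by
    rw [← ModuleCat.comp_apply, ← Functor.map_comp, kernel.lift_ι]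
  constructor
  · intro _ c s hs x hx
    have hs' : secHom s ≫ S.g = 0 := by rw [secHom_comp, hs, secHom_zero]
    obtain ⟨k, hk⟩ := secHom_surjective (kernel.lift S.g (secHom s) hs')
    have hks : (A.ev.obj c).map (kernel.ι S.g) k = s := by
      refine secHom_injective ?_
      rw [← secHom_comp, ← hk, kernel.lift_ι]
    obtain ⟨V, i, t, hxV, ht⟩ := exists_local_lift (kernel.lift S.g S.f S.zero) k x hx
    refine ⟨V, i, t, hxV, ?_⟩
    rw [← hl, ht, ← ev_naturality_apply, hks]
  · intro h
    refine epi_of_locally_surjective _ fun c k x hx => ?_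
    obtain ⟨V, i, t, hxV, ht⟩ := h c ((A.ev.obj c).map (kernel.ι S.g) k) (by
      rw [← ModuleCat.comp_apply, ← Functor.map_comp, kernel.condition, Functor.map_zero]; rfl) x hx
    refine ⟨V, i, t, hxV, ev_map_injective (kernel.ι S.g) ?_⟩
    rw [hl, ht, ev_naturality_apply]

end Sections

/-! ### Gluing and Mayer-Vietoris for sections. -/

section Restriction

variable (c : A.Total)

/-- The canonical morphism `(V, σ|_V) ⟶ (W, σ|_W)` for `W ⊆ V`. -/
def resHom {V W : Opens X} (i : V ⟶ c.base.unop) (k : W ⟶ c.base.unop) (h : W ≤ V) :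
    A.restrict c i ⟶ A.restrict c k :=
  (A.exists_fac (e := A.restrict c k) i (homOfLE h) (A.toRestrict c k)).choose

lemma toRestrict_resHom {V W : Opens X} (i : V ⟶ c.base.unop) (k : W ⟶ c.base.unop) (h : W ≤ V) :
    A.toRestrict c i ≫ A.resHom c i k h = A.toRestrict c k :=
  (A.exists_fac (e := A.restrict c k) i (homOfLE h) (A.toRestrict c k)).choose_spec

lemma resHom_comp {V W U : Opens X} (i : V ⟶ c.base.unop) (k : W ⟶ c.base.unop)
    (l : U ⟶ c.base.unop) (h : W ≤ V) (h' : U ≤ W) :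
    A.resHom c i k h ≫ A.resHom c k l h' = A.resHom c i l (h'.trans h) := by
  rw [← cancel_epi (A.toRestrict c i), ← Category.assoc]
  simp only [toRestrict_resHom]

lemma resHom_self {V : Opens X} (i : V ⟶ c.base.unop) : A.resHom c i i le_rfl = 𝟙 _ := by
  rw [← cancel_epi (A.toRestrict c i), toRestrict_resHom, Category.comp_id]

lemma precomp_comp {b c d : A.Total} (f : b ⟶ c) (g : c ⟶ d) (e : A.Total) :
    A.precomp (f ≫ g) e = A.precomp f e ∘ₗ A.precomp g e :=
  A.homModule_ext fun k => by simp

lemma precomp_resHom_injective {V W : Opens X} (i : V ⟶ c.base.unop) (k : W ⟶ c.base.unop)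
    (h : W ≤ V) (e : A.Total) : Function.Injective (A.precomp (A.resHom c i k h) e) := by
  have h' := A.precomp_toRestrict_injective k e
  rw [← A.toRestrict_resHom c i k h, precomp_comp] at h'
  exact Function.Injective.of_comp (f := A.precomp (A.toRestrict c i) e) h'

/-- Supplies the monomorphism `q₁` of `exists_comp_d_eq_of_square`; tensoring with the flat module
`R` preserves injectivity. -/
instance mono_freeRes_resHom {V W : Opens X} (i : V ⟶ c.base.unop) (k : W ⟶ c.base.unop)
    (h : W ≤ V) : Mono (A.freeRes (ModuleCat.of R R) (A.resHom c i k h)) := by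
  have : Mono ((A.tensorBimodule (ModuleCat.of R R)).map (A.resHom c i k h).op) := by
    rw [NatTrans.mono_iff_mono_app]
    intro e
    rw [ModuleCat.mono_iff_injective]
    exact Module.Flat.lTensor_preserves_injective_linearMap (M := R)
      (A.precomp (A.resHom c i k h) e.unop.unop) (A.precomp_resHom_injective c i k h _)
  exact mono_sheafifyMap _ _ _

variable {N : A.Mod}

/-- Gluing of two sections which agree on the intersection. -/
lemma exists_glue {V₀ V₁ V₂ V₁₂ : Opens X} (i₀ : V₀ ⟶ c.base.unop) (i₁ : V₁ ⟶ c.base.unop)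
    (i₂ : V₂ ⟶ c.base.unop) (i₁₂ : V₁₂ ⟶ c.base.unop) (h₁ : V₁ ≤ V₀) (h₂ : V₂ ≤ V₀)
    (h₁' : V₁₂ ≤ V₁) (h₂' : V₁₂ ≤ V₂) (hcov : V₀ ≤ V₁ ⊔ V₂) (hinf : V₁ ⊓ V₂ ≤ V₁₂)
    (n₁ : (A.ev.obj (A.restrict c i₁)).obj N) (n₂ : (A.ev.obj (A.restrict c i₂)).obj N)
    (h : (A.ev.map (A.resHom c i₁ i₁₂ h₁')).app N n₁ = (A.ev.map (A.resHom c i₂ i₁₂ h₂')).app N n₂) :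
    ∃ n : (A.ev.obj (A.restrict c i₀)).obj N,
      (A.ev.map (A.resHom c i₀ i₁ h₁)).app N n = n₁ ∧
      (A.ev.map (A.resHom c i₀ i₂ h₂)).app N n = n₂ := by
  have hN : Presieve.IsSheaf A.topology (N.obj.obj ⋙ forget _) :=
    (isSheaf_iff_isSheaf_of_type _ _).1
      ((Presheaf.isSheaf_iff_isSheaf_forget A.topology N.obj.obj (forget _)).1 N.obj.property)
  let S : Sieve (op (A.restrict c i₀)) :=
    { arrows e f := e.unop.base.unop ≤ V₁ ∨ e.unop.base.unop ≤ V₂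
      downward_closed {e e'} f hf g := hf.imp (le_trans (leOfHom g.unop.base.unop))
        (le_trans (leOfHom g.unop.base.unop)) }
  have hS : S ∈ A.topology (op (A.restrict c i₀)) := by
    intro x hx
    rcases hcov hx with hx | hx
    · exact ⟨V₁, homOfLE h₁, hx, Or.inl le_rfl⟩
    · exact ⟨V₂, homOfLE h₂, hx, Or.inr le_rfl⟩
  -- The local value is characterized by all factorizations through `V₁` or `V₂` at once, so it does
  -- not depend on the side chosen over the overlap, and compatibility of the family follows.
  have key : ∀ (e : A.Site) (f : e ⟶ op (A.restrict c i₀)), S f →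
      ∃ n : (A.ev.obj e.unop).obj N,
        (∀ k : A.restrict c i₁ ⟶ e.unop, A.toRestrict c i₁ ≫ k = A.toRestrict c i₀ ≫ f.unop →
          n = (A.ev.map k).app N n₁) ∧
        (∀ k : A.restrict c i₂ ⟶ e.unop, A.toRestrict c i₂ ≫ k = A.toRestrict c i₀ ≫ f.unop →
          n = (A.ev.map k).app N n₂) := by
    intro e f hf
    have hcompat (k₁ : A.restrict c i₁ ⟶ e.unop) (k₂ : A.restrict c i₂ ⟶ e.unop)
        (hk₁ : A.toRestrict c i₁ ≫ k₁ = A.toRestrict c i₀ ≫ f.unop)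
        (hk₂ : A.toRestrict c i₂ ≫ k₂ = A.toRestrict c i₀ ≫ f.unop) :
        (A.ev.map k₁).app N n₁ = (A.ev.map k₂).app N n₂ := by
      obtain ⟨m, hm⟩ := A.exists_fac i₁₂
        (homOfLE ((le_inf (leOfHom k₁.base.unop) (leOfHom k₂.base.unop)).trans hinf))
        (A.toRestrict c i₀ ≫ f.unop)
      have e₁ : k₁ = A.resHom c i₁ i₁₂ h₁' ≫ m := by
        rw [← cancel_epi (A.toRestrict c i₁), hk₁, ← Category.assoc, toRestrict_resHom, hm]
      have e₂ : k₂ = A.resHom c i₂ i₁₂ h₂' ≫ m := by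
        rw [← cancel_epi (A.toRestrict c i₂), hk₂, ← Category.assoc, toRestrict_resHom, hm]
      rw [e₁, e₂, ev_map_comp_apply, ev_map_comp_apply, h]
    rcases hf with hf | hf
    · obtain ⟨k, hk⟩ := A.exists_fac i₁ (homOfLE hf) (A.toRestrict c i₀ ≫ f.unop)
      refine ⟨(A.ev.map k).app N n₁, fun k' hk' => ?_, fun k' hk' => hcompat _ _ hk hk'⟩
      rw [(cancel_epi (A.toRestrict c i₁)).1 (hk.trans hk'.symm)]
    · obtain ⟨k, hk⟩ := A.exists_fac i₂ (homOfLE hf) (A.toRestrict c i₀ ≫ f.unop)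
      refine ⟨(A.ev.map k).app N n₂, fun k' hk' => (hcompat _ _ hk' hk).symm, fun k' hk' => ?_⟩
      rw [(cancel_epi (A.toRestrict c i₂)).1 (hk.trans hk'.symm)]
  choose n hn₁ hn₂ using key
  let x : Presieve.FamilyOfElements (N.obj.obj ⋙ forget _) S.arrows := fun e f hf => n e f hf
  have hx : x.Compatible := by
    rw [Presieve.compatible_iff_sieveCompatible]
    intro e e' f g hf
    change n _ _ _ = (A.ev.map g.unop).app N (n _ _ hf)
    rcases id hf with hf' | hf'
    · obtain ⟨k, hk⟩ := A.exists_fac i₁ (homOfLE hf') (A.toRestrict c i₀ ≫ f.unop)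
      rw [hn₁ _ _ hf k hk, ← ev_map_comp_apply]
      exact hn₁ _ _ _ _ (by rw [← Category.assoc, hk, Category.assoc]; rfl)
    · obtain ⟨k, hk⟩ := A.exists_fac i₂ (homOfLE hf') (A.toRestrict c i₀ ≫ f.unop)
      rw [hn₂ _ _ hf k hk, ← ev_map_comp_apply]
      exact hn₂ _ _ _ _ (by rw [← Category.assoc, hk, Category.assoc]; rfl)
  refine ⟨(hN S hS).amalgamate x hx, ?_, ?_⟩
  · refine ((hN S hS).valid_glue hx (A.resHom c i₀ i₁ h₁).op (Or.inl le_rfl)).trans ?_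
    refine (hn₁ _ _ _ (𝟙 _) ?_).trans (A.ev_map_id_apply n₁)
    exact (Category.comp_id _).trans (A.toRestrict_resHom c i₀ i₁ h₁).symm
  · refine ((hN S hS).valid_glue hx (A.resHom c i₀ i₂ h₂).op (Or.inr le_rfl)).trans ?_
    refine (hn₂ _ _ _ (𝟙 _) ?_).trans (A.ev_map_id_apply n₂)
    exact (Category.comp_id _).trans (A.toRestrict_resHom c i₀ i₂ h₂).symm

lemma eq_of_resHom_eq {V₀ V₁ V₂ : Opens X} (i₀ : V₀ ⟶ c.base.unop) (i₁ : V₁ ⟶ c.base.unop)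
    (i₂ : V₂ ⟶ c.base.unop) (h₁ : V₁ ≤ V₀) (h₂ : V₂ ≤ V₀) (hcov : V₀ ≤ V₁ ⊔ V₂)
    (m n : (A.ev.obj (A.restrict c i₀)).obj N)
    (e₁ : (A.ev.map (A.resHom c i₀ i₁ h₁)).app N m = (A.ev.map (A.resHom c i₀ i₁ h₁)).app N n)
    (e₂ : (A.ev.map (A.resHom c i₀ i₂ h₂)).app N m = (A.ev.map (A.resHom c i₀ i₂ h₂)).app N n) :
    m = n := by
  -- The restriction of `σ|_V₀` to `W` and `σ|_W` are different objects; `l` is the canonical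
  -- comparison between them.
  have aux {W : Opens X} (k : W ⟶ c.base.unop) (hk : W ≤ V₀)
      (e : (A.ev.map (A.resHom c i₀ k hk)).app N m = (A.ev.map (A.resHom c i₀ k hk)).app N n) :
      (A.ev.map (A.toRestrict (A.restrict c i₀) (homOfLE hk))).app N m =
        (A.ev.map (A.toRestrict (A.restrict c i₀) (homOfLE hk))).app N n := by
    obtain ⟨l, hl⟩ := A.exists_fac (c := c) k (𝟙 W)
      (A.toRestrict c i₀ ≫ A.toRestrict (A.restrict c i₀) (homOfLE hk))
    have : A.toRestrict (A.restrict c i₀) (homOfLE hk) = A.resHom c i₀ k hk ≫ l := by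
      rw [← cancel_epi (A.toRestrict c i₀), ← Category.assoc, toRestrict_resHom, hl]
    rw [this, ev_map_comp_apply, ev_map_comp_apply, e]
  refine A.ev_eq_of_locally_eq m n fun x hx => ?_
  rcases hcov hx with hx | hx
  · exact ⟨V₁, homOfLE h₁, hx, aux i₁ h₁ e₁⟩
  · exact ⟨V₂, homOfLE h₂, hx, aux i₂ h₂ e₂⟩

lemma freeRes_comp (L : ModuleCat.{0} R) {c d e : A.Total} (f : c ⟶ d) (g : d ⟶ e) :
    A.freeRes L (f ≫ g) = A.freeRes L g ≫ A.freeRes L f := by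
  refine A.free_hom_ext ?_
  rw [← Category.comp_id (A.freeRes L (f ≫ g)), ofFree_freeRes_comp, ofFree_freeRes_comp,
    ← Category.comp_id (A.freeRes L f), ofFree_freeRes_comp, Functor.map_comp, NatTrans.comp_app,
    Category.assoc]

/-- The Mayer-Vietoris property: a section with values in a K-injective complex is a coboundary if
it is one on two open subsets, in a compatible way on their intersection. -/
lemma exists_d_eq_of_cover {I : CochainComplex A.Mod ℤ} (hI : I.IsKInjective)
    {V₀ V₁ V₂ V₁₂ : Opens X} (i₀ : V₀ ⟶ c.base.unop)
    (i₁ : V₁ ⟶ c.base.unop) (i₂ : V₂ ⟶ c.base.unop) (i₁₂ : V₁₂ ⟶ c.base.unop) (h₁ : V₁ ≤ V₀)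
    (h₂ : V₂ ≤ V₀) (h₁' : V₁₂ ≤ V₁) (h₂' : V₁₂ ≤ V₂) (hcov : V₀ ≤ V₁ ⊔ V₂) (hinf : V₁ ⊓ V₂ ≤ V₁₂)
    {h i j k : ℤ} (hi : h + 1 = i) (hj : i + 1 = j) (hk : j + 1 = k)
    (s : (A.ev.obj (A.restrict c i₀)).obj (I.X j)) (hs : (A.ev.obj _).map (I.d j k) s = 0)
    (t₁ : (A.ev.obj (A.restrict c i₁)).obj (I.X i)) (t₂ : (A.ev.obj (A.restrict c i₂)).obj (I.X i))
    (ht₁ : (A.ev.obj _).map (I.d i j) t₁ = (A.ev.map (A.resHom c i₀ i₁ h₁)).app _ s)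
    (ht₂ : (A.ev.obj _).map (I.d i j) t₂ = (A.ev.map (A.resHom c i₀ i₂ h₂)).app _ s)
    (u : (A.ev.obj (A.restrict c i₁₂)).obj (I.X h))
    (hu : (A.ev.obj _).map (I.d h i) u = (A.ev.map (A.resHom c i₁ i₁₂ h₁')).app _ t₁ -
      (A.ev.map (A.resHom c i₂ i₁₂ h₂')).app _ t₂) :
    ∃ t : (A.ev.obj (A.restrict c i₀)).obj (I.X i), (A.ev.obj _).map (I.d i j) t = s := by
  have hm := A.mono_freeRes_resHom c i₁ i₁₂ h₁'
  -- The square consists of the extensions by zero of `𝒜(σ, ·)` from `V₁₂`, `V₁`, `V₂` and `V₀`; its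
  -- two universal properties are separatedness and gluing.
  obtain ⟨θ, hθ⟩ := exists_comp_d_eq_of_square hI (A.freeRes _ (A.resHom c i₁ i₁₂ h₁'))
    (A.freeRes _ (A.resHom c i₂ i₁₂ h₂')) (A.freeRes _ (A.resHom c i₀ i₁ h₁))
    (A.freeRes _ (A.resHom c i₀ i₂ h₂))
    (by rw [← freeRes_comp, ← freeRes_comp, resHom_comp, resHom_comp])
    (fun N a b h h' => by
      obtain ⟨m, rfl⟩ := secHom_surjective a
      obtain ⟨n, rfl⟩ := secHom_surjective b
      rw [freeRes_secHom, freeRes_secHom] at h h'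
      exact congrArg _ (A.eq_of_resHom_eq c i₀ i₁ i₂ h₁ h₂ hcov m n (secHom_injective h)
        (secHom_injective h')))
    (fun N a b h => by
      obtain ⟨n₁, rfl⟩ := secHom_surjective a
      obtain ⟨n₂, rfl⟩ := secHom_surjective b
      rw [freeRes_secHom, freeRes_secHom] at h
      obtain ⟨n, rfl, rfl⟩ := A.exists_glue c i₀ i₁ i₂ i₁₂ h₁ h₂ h₁' h₂' hcov hinf n₁ n₂
        (secHom_injective h)
      exact ⟨secHom n, freeRes_secHom _ _, freeRes_secHom _ _⟩)
    hi hj hk (secHom s) (secHom t₁) (secHom t₂) (secHom u)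
    (by rw [secHom_comp, hs, secHom_zero])
    (by rw [freeRes_secHom, secHom_comp, ht₁])
    (by rw [freeRes_secHom, secHom_comp, ht₂])
    (by rw [freeRes_secHom, freeRes_secHom, secHom_comp, hu, secHom_sub])
  obtain ⟨t, rfl⟩ := secHom_surjective θ
  refine ⟨t, secHom_injective ?_⟩
  rw [← secHom_comp, hθ]

end Restriction

end Algebroid

/-! ### The telescope resolution of a localization `R[1/r]`. -/

section Telescope

variable {R : Type} [CommRing R] (r : R)

/-- The telescope `e_n ↦ e_n - r e_{n+1}`. -/
def telescope : (ℕ →₀ R) →ₗ[R] (ℕ →₀ R) :=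
  LinearMap.id - r • Finsupp.lmapDomain R R Nat.succ

lemma telescope_apply_zero (x : ℕ →₀ R) : telescope r x 0 = x 0 := by
  simp only [telescope, LinearMap.sub_apply, LinearMap.id_apply, LinearMap.smul_apply,
    Finsupp.lmapDomain_apply, Finsupp.sub_apply, Finsupp.smul_apply]
  rw [Finsupp.mapDomain_of_notMem_range _ _ (by simp), smul_zero, sub_zero]

lemma telescope_apply_succ (x : ℕ →₀ R) (n : ℕ) :
    telescope r x (n + 1) = x (n + 1) - r * x n := by
  simp only [telescope, LinearMap.sub_apply, LinearMap.id_apply, LinearMap.smul_apply,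
    Finsupp.lmapDomain_apply, Finsupp.sub_apply, Finsupp.smul_apply, smul_eq_mul]
  rw [← Nat.succ_eq_add_one, Finsupp.mapDomain_apply Nat.succ_injective]

lemma telescope_single (n : ℕ) (a : R) :
    telescope r (Finsupp.single n a) = Finsupp.single n a - Finsupp.single (n + 1) (r * a) := by
  simp [telescope]

lemma telescope_injective : Function.Injective (telescope r) := by
  rw [injective_iff_map_eq_zero]
  intro x hx
  ext n
  induction n with
  | zero => rw [← telescope_apply_zero r x, hx]
  | succ n ih =>
    have h := telescope_apply_succ r x n
    rw [hx, ih] at h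
    simpa using h.symm

lemma single_sub_single_mem_range (n m : ℕ) (a : R) :
    Finsupp.single n a - Finsupp.single (n + m) (r ^ m * a) ∈ LinearMap.range (telescope r) := by
  induction m with
  | zero => simp
  | succ m ih =>
    have h := add_mem ih (⟨_, telescope_single r (n + m) (r ^ m * a)⟩ :
      _ ∈ LinearMap.range (telescope r))
    rwa [sub_add_sub_cancel, ← mul_assoc, ← pow_succ', add_assoc] at h

/-- Modulo the range `eₙ` equals `rᵐ eₙ₊ₘ`, so finitely many terms can be pushed to a common index.
-/
lemma exists_sub_single_mem_range (x : ℕ →₀ R) :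
    ∃ (n : ℕ) (a : R), x - Finsupp.single n a ∈ LinearMap.range (telescope r) := by
  induction x using Finsupp.induction_linear with
  | zero => exact ⟨0, 0, by simp⟩
  | single n a => exact ⟨n, a, by simp⟩
  | add x y hx hy =>
    obtain ⟨n, a, hx⟩ := hx
    obtain ⟨m, b, hy⟩ := hy
    refine ⟨n + m, r ^ m * a + r ^ n * b, ?_⟩
    have h₁ := add_mem hx (single_sub_single_mem_range r n m a)
    have h₂ := add_mem hy (single_sub_single_mem_range r m n b)
    rw [sub_add_sub_cancel] at h₁ h₂
    have h := add_mem h₁ h₂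
    rw [add_comm m n] at h
    rwa [Finsupp.single_add, add_sub_add_comm]

variable (L : Type) [CommRing L] [Algebra R L] [IsLocalization.Away r L]

/-- The augmentation `e_n ↦ r⁻ⁿ` of the telescope. -/
def telescopeAug : (ℕ →₀ R) →ₗ[R] L :=
  Finsupp.linearCombination R fun n => IsLocalization.Away.invSelf (S := L) r ^ n

lemma telescopeAug_single (n : ℕ) (a : R) : telescopeAug r L (Finsupp.single n a) =
    algebraMap R L a * IsLocalization.Away.invSelf (S := L) r ^ n := by
  rw [telescopeAug, Finsupp.linearCombination_single, Algebra.smul_def]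

lemma pow_mul_telescopeAug_single (n : ℕ) (a : R) :
    algebraMap R L r ^ n * telescopeAug r L (Finsupp.single n a) = algebraMap R L a := by
  rw [telescopeAug_single, mul_left_comm, ← mul_pow, IsLocalization.Away.mul_invSelf, one_pow,
    mul_one]

lemma telescopeAug_comp_telescope : telescopeAug r L ∘ₗ telescope r = 0 := by
  refine Finsupp.lhom_ext fun n a => ?_
  rw [LinearMap.comp_apply, telescope_single, map_sub, telescopeAug_single, telescopeAug_single,
    map_mul, pow_succ', mul_comm (algebraMap R L r), mul_assoc, ← mul_assoc (algebraMap R L r),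
    IsLocalization.Away.mul_invSelf, one_mul, sub_self, LinearMap.zero_apply]

/-- Modulo the range an element of the kernel is `a eₙ` with `a` zero in `L`. Then `rᵐ a = 0` for
some `m`, and `a eₙ` is congruent to `rᵐ a eₙ₊ₘ = 0`. -/
lemma telescope_exact : Function.Exact (telescope r) (telescopeAug r L) := by
  refine fun x => ⟨fun hx => ?_, ?_⟩
  · obtain ⟨n, a, h⟩ := exists_sub_single_mem_range r x
    obtain ⟨y, hy⟩ := id h
    have ha : algebraMap R L a = algebraMap R L 0 := by
      have h0 : telescopeAug r L (x - Finsupp.single n a) = 0 := by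
        rw [← hy]
        exact LinearMap.congr_fun (telescopeAug_comp_telescope r L) y
      rw [map_sub, hx, zero_sub, neg_eq_zero] at h0
      rw [← pow_mul_telescopeAug_single r L n a, h0, mul_zero, map_zero]
    obtain ⟨⟨_, m, rfl⟩, hm⟩ := (IsLocalization.eq_iff_exists (Submonoid.powers r) L).1 ha
    have h' := add_mem h (single_sub_single_mem_range r n m a)
    have hm' : r ^ m * a = 0 := by simpa using hm
    rwa [sub_add_sub_cancel, hm', Finsupp.single_zero, sub_zero] at h'
  · rintro ⟨y, rfl⟩
    exact LinearMap.congr_fun (telescopeAug_comp_telescope r L) y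

lemma telescopeAug_surjective : Function.Surjective (telescopeAug r L) := by
  intro l
  obtain ⟨n, a, h⟩ := IsLocalization.Away.surj r l
  refine ⟨Finsupp.single n a, ?_⟩
  rw [telescopeAug_single, ← h, mul_assoc, ← mul_pow, IsLocalization.Away.mul_invSelf, one_pow,
    mul_one]

end Telescope

/-! ### Cohomology of `ℋom(L ⊗ 𝒜, I)`. -/

namespace Algebroid

variable {R : Type} [CommRing R] {X : TopCat.{0}} (A : Algebroid R X)

/-- A morphism from `L` to the sections of a K-injective complex is a coboundary if this holds,
in a compatible way, for the terms of a resolution of `L`. -/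
lemma exists_d_eq_of_resolution {I : CochainComplex A.Mod ℤ} (hI : I.IsKInjective) (c : A.Total)
    {F₁ F₀ L : ModuleCat.{0} R} (f : F₁ ⟶ F₀) (g : F₀ ⟶ L) (hf : Function.Injective f)
    (hg : Function.Surjective g) (hfg : Function.Exact f g) [Module.Flat R L]
    {h i j k : ℤ} (hi : h + 1 = i) (hj : i + 1 = j) (hk : j + 1 = k)
    (φ : L ⟶ (A.ev.obj c).obj (I.X j)) (ψ : F₀ ⟶ (A.ev.obj c).obj (I.X i))
    (χ : F₁ ⟶ (A.ev.obj c).obj (I.X h)) (hφ : φ ≫ (A.ev.obj c).map (I.d j k) = 0)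
    (hψ : g ≫ φ = ψ ≫ (A.ev.obj c).map (I.d i j)) (hχ : f ≫ ψ = χ ≫ (A.ev.obj c).map (I.d h i)) :
    ∃ θ : L ⟶ (A.ev.obj c).obj (I.X i), θ ≫ (A.ev.obj c).map (I.d i j) = φ := by
  have w : f ≫ g = 0 := by
    ext x
    exact hfg.apply_apply_eq_zero x
  have hmono : Mono (A.freeMap f c) := by
    have : Mono (A.tensorBimoduleMap f (op c)) := by
      rw [NatTrans.mono_iff_mono_app]
      intro e
      rw [ModuleCat.mono_iff_injective]
      -- Flatness of `L`, the cokernel of `f`, keeps `f` injective after tensoring with any module.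
      exact (LinearMap.lTensor_inj_iff_rTensor_inj _ _).1
        (LinearMap.lTensor_injective_of_exact_of_flat g.hom hg f.hom hf hfg
          (A.homModule c e.unop.unop))
    exact mono_sheafifyMap _ _ _
  let S : ShortComplex A.Mod := ShortComplex.mk (A.freeMap f c) (A.freeMap g c) (by
    refine A.free_hom_ext ?_
    rw [ofFree_freeMap_comp, ← Category.comp_id (A.freeMap g c), ofFree_freeMap_comp, ofFree_zero,
      ← Category.assoc, w, zero_comp])
  have hS : S.ShortExact := by
    refine shortExact_of_hom _ hmono (fun N a b hab => ?_) fun N a ha => ?_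
    · refine A.free_hom_ext ?_
      have : Epi g := (ModuleCat.epi_iff_surjective g).2 hg
      rw [← cancel_epi g, ← ofFree_freeMap_comp, ← ofFree_freeMap_comp]
      exact congrArg _ hab
    · have ha' : f ≫ A.ofFree F₀ a = 0 := by
        rw [← ofFree_freeMap_comp, ← ofFree_zero]
        exact congrArg _ ha
      have hexact : (ShortComplex.mk f g w).Exact :=
        (ShortComplex.ShortExact.moduleCat_exact_iff_function_exact _).2 hfg
      have : Epi (ShortComplex.mk f g w).g := (ModuleCat.epi_iff_surjective g).2 hg
      refine ⟨A.freeDesc L c (hexact.desc (A.ofFree F₀ a) ha'), A.free_hom_ext ?_⟩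
      refine (A.ofFree_freeMap_comp g c _).trans ?_
      rw [ofFree_freeDesc]
      exact hexact.g_desc _ _
  obtain ⟨θ, hθ⟩ := exists_comp_d_eq hI hS hi hj hk (A.freeDesc L c φ) (A.freeDesc F₀ c ψ)
    (A.freeDesc F₁ c χ)
    (A.free_hom_ext (by rw [ofFree_comp, ofFree_freeDesc, hφ, ofFree_zero]))
    (A.free_hom_ext (by
      refine (A.ofFree_freeMap_comp g c _).trans ?_
      rw [ofFree_comp, ofFree_freeDesc, ofFree_freeDesc, hψ]))
    (A.free_hom_ext (by
      refine (A.ofFree_freeMap_comp f c _).trans ?_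
      rw [ofFree_comp, ofFree_freeDesc, ofFree_freeDesc, hχ]))
  refine ⟨A.ofFree L θ, ?_⟩
  rw [← ofFree_comp, hθ, ofFree_freeDesc]

section HomMod

variable (L : ModuleCat.{0} R) {c d : A.Total} {M N : A.Mod}

/-- The sections of `ℋom_𝒜(L ⊗ 𝒜, N)` over `c` as morphisms from `L` to the sections of `N`. -/
def homModEval (s : (A.ev.obj c).obj ((A.homMod L).obj N)) : L ⟶ (A.ev.obj c).obj N :=
  (A.evalAtUnit L N.obj.obj).app (op (op c)) s

lemma homModEval_bijective : Function.Bijective (A.homModEval L (c := c) (N := N)) := by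
  have := isIso_evalAtUnit L N.property
  exact (ConcreteCategory.isIso_iff_bijective ((A.evalAtUnit L N.obj.obj).app (op (op c)))).1
    inferInstance

lemma homModEval_map (f : M ⟶ N) (s : (A.ev.obj c).obj ((A.homMod L).obj M)) :
    A.homModEval L ((A.ev.obj c).map ((A.homMod L).map f) s) =
      A.homModEval L s ≫ (A.ev.obj c).map f :=
  rfl

lemma homModEval_res (g : c ⟶ d) (s : (A.ev.obj c).obj ((A.homMod L).obj N)) :
    A.homModEval L ((A.ev.map g).app _ s) = A.homModEval L s ≫ (A.ev.map g).app N :=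
  NatTrans.naturality_apply (A.evalAtUnit L N.obj.obj) g.op.op s

lemma homModEval_zero : A.homModEval L (0 : (A.ev.obj c).obj ((A.homMod L).obj N)) = 0 :=
  map_zero ((A.evalAtUnit L N.obj.obj).app (op (op c))).hom

end HomMod

/-- The cocycles of `I` of degree larger than `a` are coboundaries on small open subsets, which do
not depend on the cocycle. -/
def LocallyVanishing (I : CochainComplex A.Mod ℤ) (a : ℤ) : Prop :=
  ∀ (c : A.Total), ∀ x ∈ c.base.unop, ∃ (V : Opens X) (v : V ⟶ c.base.unop), x ∈ V ∧
    ∀ (i j k : ℤ), i + 1 = j → j + 1 = k → a < j → ∀ s : (A.ev.obj c).obj (I.X j),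
      (A.ev.obj c).map (I.d j k) s = 0 → ∃ t : (A.ev.obj (A.restrict c v)).obj (I.X i),
        (A.ev.obj _).map (I.d i j) t = (A.ev.map (A.toRestrict c v)).app _ s

variable {A} in
-- A map out of `R^(ℕ)` is a sequence of sections. The uniform `V` is essential: neighbourhoods
-- chosen for each term separately could have an intersection that is not open.
lemma LocallyVanishing.exists_linearMap {I : CochainComplex A.Mod ℤ} {a : ℤ}
    (H : A.LocallyVanishing I a) (c : A.Total) (x : X) (hx : x ∈ c.base.unop) :
    ∃ (V : Opens X) (v : V ⟶ c.base.unop), x ∈ V ∧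
      ∀ (i j k : ℤ), i + 1 = j → j + 1 = k → a < j →
        ∀ φ : ModuleCat.of R (ℕ →₀ R) ⟶ (A.ev.obj c).obj (I.X j),
        φ ≫ (A.ev.obj c).map (I.d j k) = 0 →
          ∃ ψ : ModuleCat.of R (ℕ →₀ R) ⟶ (A.ev.obj (A.restrict c v)).obj (I.X i),
            ψ ≫ (A.ev.obj _).map (I.d i j) = φ ≫ (A.ev.map (A.toRestrict c v)).app _ := by
  obtain ⟨V, v, hxV, hV⟩ := H c x hx
  refine ⟨V, v, hxV, fun i j k hj hk ha φ hφ => ?_⟩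
  choose t ht using fun n : ℕ => hV i j k hj hk ha (φ (Finsupp.single n 1))
    (congrArg (fun t : ModuleCat.of R (ℕ →₀ R) ⟶ _ => t (Finsupp.single n 1)) hφ)
  refine ⟨ModuleCat.ofHom (Finsupp.linearCombination R t), ?_⟩
  ext n
  refine Eq.trans ?_ (ht n)
  refine congrArg ((A.ev.obj (A.restrict c v)).map (I.d i j)) ?_
  change Finsupp.linearCombination R t (Finsupp.single n 1) = t n
  simp

/-- If `L` is a flat `R`-module with a presentation by a telescope, and if the cocycles of the
K-injective complex `I` of degree larger than `a` vanish locally, then the cohomology of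
`ℋom_𝒜(L ⊗ 𝒜, I)` vanishes in degrees larger than `a + 1`. -/
lemma exactAt_homMod {I : CochainComplex A.Mod ℤ} (hI : I.IsKInjective) {a : ℤ}
    (H : A.LocallyVanishing I a) {L : ModuleCat.{0} R} [Module.Flat R L]
    (f : ModuleCat.of R (ℕ →₀ R) ⟶ ModuleCat.of R (ℕ →₀ R)) (g : ModuleCat.of R (ℕ →₀ R) ⟶ L)
    (hf : Function.Injective f) (hg : Function.Surjective g) (hfg : Function.Exact f g)
    (j : ℤ) (hj : a + 1 < j) :
    (((A.homMod L).mapHomologicalComplex (ComplexShape.up ℤ)).obj I).ExactAt j := by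
  rw [HomologicalComplex.exactAt_iff' _ (j - 1) j (j + 1) (by simp) (by simp), exact_iff_locally]
  intro c s hs x hx
  change (A.ev.obj c).obj ((A.homMod L).obj (I.X j)) at s
  change (A.ev.obj c).map ((A.homMod L).map (I.d j (j + 1))) s = 0 at hs
  have hφ : A.homModEval L s ≫ (A.ev.obj c).map (I.d j (j + 1)) = 0 := by
    rw [← homModEval_map, hs, homModEval_zero]
  obtain ⟨V, v, hxV, hV⟩ := H.exists_linearMap c x hx
  obtain ⟨ψ, hψ⟩ := hV (j - 1) j (j + 1) (by omega) (by omega) (by omega) (g ≫ A.homModEval L s)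
    (by rw [Category.assoc, hφ, comp_zero])
  obtain ⟨W, w, hxW, hW⟩ := H.exists_linearMap (A.restrict c v) x hxV
  have hfg0 : f ≫ g = 0 :=
    ModuleCat.hom_ext (LinearMap.ext fun y => hfg.apply_apply_eq_zero y)
  -- `f ≫ ψ` measures the failure of `ψ` to descend to `L`. It takes values in cocycles because `f ≫
  -- g = 0`; their degree is `j - 1`, hence the bound `a + 1 < j`.
  obtain ⟨χ, hχ⟩ := hW (j - 2) (j - 1) j (by omega) (by omega) (by omega) (f ≫ ψ) (by
    rw [Category.assoc, hψ, ← Category.assoc, ← Category.assoc, hfg0, zero_comp, zero_comp])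
  obtain ⟨θ, hθ⟩ := A.exists_d_eq_of_resolution hI (A.restrict (A.restrict c v) w) f g hf hg hfg
    (h := j - 2) (i := j - 1) (j := j) (k := j + 1) (by omega) (by omega) (by omega)
    (A.homModEval L s ≫ (A.ev.map (A.toRestrict c v)).app _ ≫ (A.ev.map (A.toRestrict _ w)).app _)
    (ψ ≫ (A.ev.map (A.toRestrict _ w)).app _) χ
    (by
      simp only [Category.assoc, ← NatTrans.naturality, ← NatTrans.naturality_assoc]
      rw [reassoc_of% hφ, zero_comp])
    (by
      simp only [Category.assoc, ← NatTrans.naturality]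
      rw [reassoc_of% hψ])
    (by rw [hχ, Category.assoc])
  -- `m` compares the iterated restriction to `V` and then `W` with the direct restriction to `W`.
  obtain ⟨l, hl⟩ := A.exists_fac v w (A.toRestrict c (w ≫ v))
  obtain ⟨m, hm⟩ := A.exists_fac w (𝟙 _) l
  obtain ⟨t, ht⟩ := (A.homModEval_bijective L).2 (θ ≫ (A.ev.map m).app _)
  refine ⟨W, w ≫ v, t, hxW, (A.homModEval_bijective L).1 ?_⟩
  refine (A.homModEval_map L (I.d (j - 1) j) t).trans ?_
  rw [ht]
  refine Eq.trans ?_ (A.homModEval_res L (A.toRestrict c (w ≫ v)) s).symm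
  rw [Category.assoc, ← NatTrans.naturality, reassoc_of% hθ, ← hl, ← hm, Functor.map_comp,
    Functor.map_comp]
  simp only [NatTrans.comp_app]

/-! ### The Mayer-Vietoris theory of a K-injective complex. -/

section Theory

variable {Y : Type} [TopologicalSpace Y] {p : Y → X} (hp : Topology.IsOpenEmbedding p)
  (c : A.Total) (hc : ∀ y, p y ∈ c.base.unop)

/-- The image of an open subset under an open embedding. -/
def image (W : Opens Y) : Opens X := ⟨p '' W, hp.isOpenMap W W.isOpen⟩

lemma image_mono {V W : Opens Y} (h : V ≤ W) : image hp V ≤ image hp W := Set.image_mono h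

/-- The inclusion of the image of an open subset. -/
def imageHom (W : Opens Y) : image hp W ⟶ c.base.unop :=
  homOfLE (by rintro _ ⟨y, -, rfl⟩; exact hc y)

/-- The restriction of `c` to the image of an open subset. -/
abbrev restrictImage (W : Opens Y) : A.Total := A.restrict c (imageHom A hp c hc W)

/-- The restriction morphism between the images of two open subsets. -/
abbrev resImage {V W : Opens Y} (h : V ≤ W) :
    A.restrictImage hp c hc W ⟶ A.restrictImage hp c hc V :=
  A.resHom c _ _ (image_mono hp h)

/-- The classes of the cocycles of a K-injective complex, up to coboundaries. -/
def sectionTheory (I : CochainComplex A.Mod ℤ) (hI : I.IsKInjective) (b : ℤ)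
    (hb : ∀ j, b < j → I.ExactAt j) : MayerVietorisTheory Y b where
  Cls j W := {s : (A.ev.obj (A.restrictImage hp c hc W)).obj (I.X j) //
    (A.ev.obj _).map (I.d j (j + 1)) s = 0}
  res h s := ⟨(A.ev.map (A.resImage hp c hc h)).app _ s.1, by
    rw [← ev_naturality_apply, s.2, map_zero]⟩
  -- Keeping the degree of the primitive as a variable `i` with `i + 1 = j` avoids transport along
  -- `j + 1 - 1 = j`.
  Null {j W} s := ∃ (i : ℤ) (_ : i + 1 = j) (t : (A.ev.obj (A.restrictImage hp c hc W)).obj (I.X i)),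
    (A.ev.obj _).map (I.d i j) t = s.1
  res_res h h' s := by
    refine Subtype.ext ?_
    change (A.ev.map _).app _ ((A.ev.map _).app _ s.1) = _
    rw [← ev_map_comp_apply, resHom_comp]
  res_self s := by
    refine Subtype.ext ?_
    change (A.ev.map (A.resHom c _ _ le_rfl)).app _ s.1 = _
    rw [resHom_self, ev_map_id_apply]
  null_res h s := by
    rintro ⟨i, hi, t, ht⟩
    refine ⟨i, hi, (A.ev.map (A.resImage hp c hc h)).app _ t, ?_⟩
    rw [← ev_naturality_apply, ht]
  null_bot {j} s := by
    refine ⟨j - 1, by ring, 0, A.ev_eq_of_locally_eq _ _ fun x hx => ?_⟩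
    obtain ⟨y, hy, -⟩ := hx
    exact hy.elim
  locally_null {j} hj {W} s x hx := by
    have hI' := hb j hj
    rw [HomologicalComplex.exactAt_iff' _ (j - 1) j (j + 1) (by simp) (by simp),
      exact_iff_locally] at hI'
    obtain ⟨V, v, t, hxV, ht⟩ := hI' _ s.1 s.2 (p x) ⟨x, hx, rfl⟩
    change (A.ev.obj _).obj (I.X (j - 1)) at t
    let V' : Opens Y := ⟨p ⁻¹' V, V.isOpen.preimage hp.continuous⟩ ⊓ W
    have hV' : image hp V' ≤ V := by
      rintro _ ⟨y, hy, rfl⟩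
      exact hy.1
    obtain ⟨l, hl⟩ := A.exists_fac (e := A.restrictImage hp c hc V') v (homOfLE hV')
      (A.resImage hp c hc (inf_le_right : V' ≤ W))
    refine ⟨V', inf_le_right, ⟨hxV, hx⟩, j - 1, by ring, (A.ev.map l).app _ t, ?_⟩
    change _ = (A.ev.map (A.resImage hp c hc (inf_le_right : V' ≤ W))).app _ s.1
    rw [← ev_naturality_apply, ← hl, ev_map_comp_apply]
    exact congrArg _ ht
  mayerVietoris {j W₁ W₂} s := by
    rintro ⟨i, hi, t₁, ht₁⟩ ⟨i', hi', t₂, ht₂⟩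
    obtain rfl : j = i := by omega
    obtain rfl : j = i' := by omega
    -- The obstruction is the difference of the two primitives, as for the connecting map of the
    -- Mayer-Vietoris sequence.
    refine ⟨⟨(A.ev.map (A.resImage hp c hc (inf_le_left : W₁ ⊓ W₂ ≤ W₁))).app _ t₁ -
      (A.ev.map (A.resImage hp c hc (inf_le_right : W₁ ⊓ W₂ ≤ W₂))).app _ t₂, ?_⟩, ?_⟩
    · rw [map_sub, ← ev_naturality_apply, ← ev_naturality_apply, ht₁, ht₂, sub_eq_zero]
      change (A.ev.map _).app _ ((A.ev.map _).app _ s.1) =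
        (A.ev.map _).app _ ((A.ev.map _).app _ s.1)
      rw [← ev_map_comp_apply, ← ev_map_comp_apply, resHom_comp, resHom_comp]
    · rintro V₁ V₂ h₁ h₂ ⟨h, rfl, u, hu⟩
      have hd₁ : (A.ev.obj _).map (I.d (h + 1) (h + 1 + 1)) t₁ =
        (A.ev.map (A.resImage hp c hc (le_sup_left : W₁ ≤ W₁ ⊔ W₂))).app _ s.1 := ht₁
      have hd₂ : (A.ev.obj _).map (I.d (h + 1) (h + 1 + 1)) t₂ =
        (A.ev.map (A.resImage hp c hc (le_sup_right : W₂ ≤ W₁ ⊔ W₂))).app _ s.1 := ht₂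
      obtain ⟨t, ht⟩ := A.exists_d_eq_of_cover c hI (imageHom A hp c hc (V₁ ⊔ V₂))
        (imageHom A hp c hc V₁) (imageHom A hp c hc V₂) (imageHom A hp c hc (V₁ ⊓ V₂))
        (image_mono hp le_sup_left) (image_mono hp le_sup_right)
        (image_mono hp inf_le_left) (image_mono hp inf_le_right)
        (by
          rintro _ ⟨y, hy | hy, rfl⟩
          · exact Or.inl ⟨y, hy, rfl⟩
          · exact Or.inr ⟨y, hy, rfl⟩)
        (by
          rintro _ ⟨⟨y, hy, rfl⟩, ⟨y', hy', h⟩⟩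
          obtain rfl := hp.injective h
          exact ⟨y', ⟨hy, hy'⟩, rfl⟩)
        (h := h) (i := h + 1) (j := h + 1 + 1) (k := h + 1 + 1 + 1) rfl rfl rfl
        ((A.ev.map (A.resImage hp c hc (sup_le_sup h₁ h₂))).app _ s.1)
        (by rw [← ev_naturality_apply, s.2, map_zero])
        ((A.ev.map (A.resImage hp c hc h₁)).app _ t₁) ((A.ev.map (A.resImage hp c hc h₂)).app _ t₂)
        (by rw [← ev_naturality_apply, hd₁, ← ev_map_comp_apply, ← ev_map_comp_apply, resHom_comp,
          resHom_comp])
        (by rw [← ev_naturality_apply, hd₂, ← ev_map_comp_apply, ← ev_map_comp_apply, resHom_comp,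
          resHom_comp])
        u (by
          refine hu.trans ?_
          change (A.ev.map _).app _ (_ - _) = _
          rw [map_sub, ← ev_map_comp_apply, ← ev_map_comp_apply, ← ev_map_comp_apply,
            ← ev_map_comp_apply, resHom_comp, resHom_comp, resHom_comp, resHom_comp])
      exact ⟨h + 1, rfl, t, ht⟩

end Theory

/-- Uniformity in the cocycle comes from `HasLocalDimLE`, which fixes `V` before the theory and the
class. -/
lemma locallyVanishing {d : ℕ} (hX : HasLocalDimLE X d) (I : CochainComplex A.Mod ℤ)
    (hI : I.IsKInjective) (b : ℤ) (hb : ∀ j, b < j → I.ExactAt j) :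
    A.LocallyVanishing I (b + d) := by
  intro c x hx
  obtain ⟨Y, _, p, hp, y, V, rfl, hpU, hyV, H⟩ := hX c.base.unop x hx
  refine ⟨image hp V, imageHom A hp c hpU V, ⟨y, hyV, rfl⟩, ?_⟩
  rintro i j _ hj rfl hdj s hs
  obtain ⟨i', hi', t, ht⟩ := H b (A.sectionTheory hp c hpU I hI b hb) j
    ⟨(A.ev.map (A.toRestrict c (imageHom A hp c hpU ⊤))).app _ s, by
      rw [← ev_naturality_apply, hs, map_zero]⟩ hdj
  obtain rfl : i = i' := by omega
  refine ⟨t, ht.trans ?_⟩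
  change (A.ev.map _).app _ ((A.ev.map _).app _ s) = _
  rw [← ev_map_comp_apply, toRestrict_resHom]

end Algebroid

/-! ### From the local dimension to boundedness above. -/

open Algebroid in
lemma minus_of_hasLocalDimLE {X : SmoothComplexVariety} {d : ℕ}
    (hX : HasLocalDimLE X.toCAlgSpace.space d) (A : DQAlgebroid X)
    [HasDerivedCategory.{w} A.Mod] (M N : DerivedCategory A.Mod)
    (hM : DerivedCategory.TStructure.t.minus M) (hN : A.IsRHomLoc M N) :
    DerivedCategory.TStructure.t.minus N := by
  obtain ⟨b, hb⟩ := hM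
  obtain ⟨I, hI, ⟨e⟩, ⟨e'⟩⟩ := hN
  have hIb : I.IsLE b := by
    rw [← DerivedCategory.isLE_Q_obj_iff]
    exact ⟨(DerivedCategory.TStructure.t.le b).prop_of_iso e.symm hb.le⟩
  have hIe (j : ℤ) (hj : b < j) : I.ExactAt j := I.exactAt_of_isLE b j hj
  have H := A.toAlgebroid.locallyVanishing hX I hI b hIe
  have : IsLocalization.Away (PowerSeries.X : ℂ⟦X⟧) ℂ⸨X⸩ :=
    inferInstanceAs (IsLocalization (Submonoid.powers (PowerSeries.X : ℂ⟦X⟧)) ℂ⸨X⸩)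
  have : Module.Flat ℂ⟦X⟧ (ModuleCat.of ℂ⟦X⟧ ℂ⸨X⸩) :=
    IsLocalization.flat ℂ⸨X⸩ (Submonoid.powers (PowerSeries.X : ℂ⟦X⟧))
  -- `d` accounts for the space and `1` for the length of the telescope resolution.
  refine ⟨b + d + 1, ⟨?_⟩⟩
  refine (DerivedCategory.TStructure.t.le (b + d + 1)).prop_of_iso e' ?_
  have hle : CochainComplex.IsLE (((A.toAlgebroid.homMod
      (ModuleCat.of ℂ⟦X⟧ ℂ⸨X⸩)).mapHomologicalComplex (ComplexShape.up ℤ)).obj I)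
      (b + d + 1) := by
    rw [CochainComplex.isLE_iff]
    intro j hj
    exact A.toAlgebroid.exactAt_homMod hI H
      (ModuleCat.ofHom (telescope (PowerSeries.X : ℂ⟦X⟧)))
      (ModuleCat.ofHom (telescopeAug (PowerSeries.X : ℂ⟦X⟧) ℂ⸨X⸩))
      (telescope_injective _) (telescopeAug_surjective _ _) (telescope_exact _ _) j hj
  exact ((DerivedCategory.isLE_Q_obj_iff _ _).2 hle).le

/-! ### Local dimension of algebraic and analytic varieties. -/

/-- An algebra of finite type over a field is Noetherian and the heights of its primes are
bounded. -/
lemma isNoetherianRing_and_exists_height_le (k R : Type) [Field k] [CommRing R] [Algebra k R]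
    (h : Algebra.FiniteType k R) :
    IsNoetherianRing R ∧ ∃ d : ℕ, ∀ p : PrimeSpectrum R, p.asIdeal.height ≤ d := by
  refine ⟨Algebra.FiniteType.isNoetherianRing k R, ?_⟩
  obtain ⟨n, f, hf⟩ := Algebra.FiniteType.iff_quotient_mvPolynomial''.mp h
  refine ⟨n, fun p => ?_⟩
  have h1 := ringKrullDim_le_of_surjective f.toRingHom hf
  rw [MvPolynomial.ringKrullDim_of_isNoetherianRing, ringKrullDim_eq_zero_of_field] at h1
  have h2 := (Ideal.height_le_ringKrullDim_of_ne_top (I := p.asIdeal) p.2.ne_top).trans h1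
  rw [zero_add, Nat.card_eq_fintype_card, Fintype.card_fin] at h2
  exact_mod_cast h2

/-- The height of a prime serves as codimension: being finite, it increases strictly along proper
specializations. `null_of_noetherian` wants a strict bound, hence `d + 1`. -/
lemma MayerVietorisTheory.null_of_isOpenEmbedding_primeSpectrum {R : Type} [CommRing R]
    [IsNoetherianRing R] {d : ℕ} (hd : ∀ p : PrimeSpectrum R, p.asIdeal.height ≤ d)
    {Y : Type} [TopologicalSpace Y] {q : Y → PrimeSpectrum R} (hq : Topology.IsOpenEmbedding q)
    {b : ℤ} (T : MayerVietorisTheory Y b) {j : ℤ} (hj : b + d < j) {W : Opens Y} (s : T.Cls j W) :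
    T.Null s := by
  have : NoetherianSpace Y := hq.isInducing.noetherianSpace
  have : QuasiSober Y := hq.quasiSober
  have htop (p : PrimeSpectrum R) : p.asIdeal.height ≠ ⊤ :=
    ((hd p).trans_lt (ENat.natCast_lt_top d)).ne
  refine T.null_of_noetherian (fun y => (q y).asIdeal.height.toNat) (fun x y hyx hne => ?_)
    (d + 1) (fun x => ?_) (by push_cast; omega) s
  · have hle : q y ≤ q x := (PrimeSpectrum.le_iff_specializes _ _).mpr (hyx.map hq.continuous)
    have hlt : (q y).asIdeal < (q x).asIdeal :=
      lt_of_le_of_ne hle fun h => hne (hq.injective (PrimeSpectrum.ext h))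
    have := Ideal.height_strict_mono_of_isPrime_of_isPrime hlt
    rw [← ENat.natCast_toNat (htop (q y)), ← ENat.natCast_toNat (htop (q x))] at this
    exact_mod_cast this
  · have := hd (q x)
    rw [← ENat.natCast_toNat (htop (q x))] at this
    exact Nat.lt_succ_of_le (by exact_mod_cast this)

/-- Quasi-compactness gives a finite affine cover, so the bounds on heights have a maximum. On an
open subset of an affine chart vanishing holds without shrinking, which allows `V = ⊤`. -/
lemma exists_hasLocalDimLE_of_locallyOfFiniteType (S : Scheme.{0}) (f : S ⟶ Spec (CommRingCat.of ℂ))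
    [LocallyOfFiniteType f] [QuasiCompact f] : ∃ d : ℕ, HasLocalDimLE S.toTopCat d := by
  have : CompactSpace S := QuasiCompact.compactSpace_of_compactSpace f
  let 𝒰 := S.affineCover.finiteSubcover
  let W (i : 𝒰.I₀) : S.Opens := (𝒰.f i).opensRange
  have hW (i) : IsAffineOpen (W i) :=
    have : IsAffine (𝒰.X i) := by dsimp [𝒰]; infer_instance
    isAffineOpen_opensRange _
  have hfin (i) : IsNoetherianRing Γ(S, W i) ∧
      ∃ d : ℕ, ∀ p : PrimeSpectrum Γ(S, W i), p.asIdeal.height ≤ d := by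
    have h1 : (f.appLE ⊤ (W i) (by simp)).hom.FiniteType :=
      f.finiteType_appLE (isAffineOpen_top _) (hW i) (by simp)
    have h2 := h1.comp (RingHom.FiniteType.of_surjective
      (Scheme.ΓSpecIso (CommRingCat.of ℂ)).inv.hom
      (Scheme.ΓSpecIso (CommRingCat.of ℂ)).commRingCatIsoToRingEquiv.symm.surjective)
    exact @isNoetherianRing_and_exists_height_le ℂ _ _ _ (RingHom.toAlgebra _) h2
  choose hnoeth d hd using hfin
  refine ⟨Finset.univ.sup d, fun U x hx => ?_⟩
  obtain ⟨i, z, hz⟩ := 𝒰.exists_eq x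
  have hxi : x ∈ Set.range (hW i).fromSpec := by
    rw [(hW i).range_fromSpec]; exact ⟨z, hz⟩
  obtain ⟨y, hy⟩ := hxi
  have hp : Topology.IsOpenEmbedding (hW i).fromSpec := (hW i).fromSpec.isOpenEmbedding
  let O : Opens (PrimeSpectrum Γ(S, W i)) := ⟨(hW i).fromSpec ⁻¹' (U : Set S.toTopCat), U.isOpen.preimage hp.continuous⟩
  have hO := O.isOpen.isOpenEmbedding_subtypeVal
  refine ⟨O, inferInstance, fun y => (hW i).fromSpec y.1, hp.comp hO,
    ⟨y, by change (hW i).fromSpec y ∈ U; rwa [hy]⟩, ⊤, hy, fun y => y.2, trivial, fun b T j s hj => ?_⟩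
  have := hnoeth i
  refine T.null_of_isOpenEmbedding_primeSpectrum (hd i) hO (lt_of_le_of_lt ?_ hj) _
  have : d i ≤ Finset.univ.sup d := Finset.le_sup (Finset.mem_univ i)
  omega

/-- The real and imaginary parts of the `n` coordinates are `2n` continuous functions that separate
the points of a chart; `V` is the interior of a compact neighbourhood inside it. -/
lemma hasLocalDimLE_of_chartedSpace (n : ℕ) (M : Type) [TopologicalSpace M]
    [ChartedSpace (EuclideanSpace ℂ (Fin n)) M] : HasLocalDimLE M (2 * n) := by
  intro U x hx
  let e := chartAt (EuclideanSpace ℂ (Fin n)) x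
  let O : Opens M := U ⊓ ⟨e.source, e.open_source⟩
  have hxO : x ∈ O := ⟨hx, mem_chart_source _ x⟩
  have : LocallyCompactSpace M := ChartedSpace.locallyCompactSpace (EuclideanSpace ℂ (Fin n)) M
  have : LocallyCompactSpace O := O.isOpen.locallyCompactSpace
  obtain ⟨K, hK, hxK⟩ := exists_compact_mem_nhds (⟨x, hxO⟩ : O)
  have he : Continuous fun y : O => e y :=
    continuousOn_iff_continuous_domRestrict.mp (e.continuousOn.mono fun y (hy : y ∈ O) => hy.2)
  have hcoord (k : Fin n) : Continuous fun y : O => e y k :=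
    (EuclideanSpace.proj (𝕜 := ℂ) k).continuous.comp he
  -- Indices below `n` give real parts, those from `n` to `2n - 1` imaginary parts; the value `0`
  -- beyond is never consulted.
  let g (i : ℕ) (y : O) : ℝ :=
    if h : i < n then (e y ⟨i, h⟩).re else if h : i - n < n then (e y ⟨i - n, h⟩).im else 0
  have hg (i : ℕ) : Continuous (g i) := by
    dsimp only [g]
    split_ifs with h h'
    · exact Complex.continuous_re.comp (hcoord _)
    · exact Complex.continuous_im.comp (hcoord _)
    · exact continuous_const
  refine ⟨O, inferInstance, Subtype.val, O.isOpen.isOpenEmbedding_subtypeVal, ⟨x, hxO⟩,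
    ⟨interior K, isOpen_interior⟩, rfl, fun y => y.2.1, mem_interior_iff_mem_nhds.mpr hxK,
    fun b T j s hj => ?_⟩
  obtain ⟨V, hV, hKV, hs⟩ := T.exists_null_of_isCompact g hg (2 * n) hj s hK (fun _ _ => trivial) (by
    intro y _ z _ hyz
    refine Subtype.ext (e.injOn y.2.2 z.2.2 ?_)
    ext k
    refine Complex.ext ?_ ?_
    · simpa [g] using hyz k (by omega)
    · simpa [g] using hyz (n + k) (by omega))
  exact T.null_of_le hs (fun y hy => hKV (interior_subset hy))

lemma SmoothComplexVariety.exists_hasLocalDimLE (X : SmoothComplexVariety) :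
    ∃ d : ℕ, HasLocalDimLE X.toCAlgSpace.space d := by
  cases X with
  | algebraic S f hf _ _ => exact exists_hasLocalDimLE_of_locallyOfFiniteType S f
  | analytic n M => exact ⟨2 * n, hasLocalDimLE_of_chartedSpace n M⟩

end DQ

end

/-- Let `X` be a smooth complex (algebraic or analytic) variety with a DQ-algebroid `𝒜_X`. The functor
`Rℋom_{𝒜_X}(𝒜_X^loc, ·)` sends `D⁻(𝒜_X)` into `D⁻(𝒜_X)`. -/
theorem corollary4p4 (X : DQ.SmoothComplexVariety) (A : DQ.DQAlgebroid X)
    [HasDerivedCategory.{w} A.Mod] (M N : DerivedCategory A.Mod)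
    (hM : DerivedCategory.TStructure.t.minus M) (hN : A.IsRHomLoc M N) :
    DerivedCategory.TStructure.t.minus N := by
  obtain ⟨d, hX⟩ := X.exists_hasLocalDimLE
  exact DQ.minus_of_hasLocalDimLE hX A M N hM hN
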